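/- Let $3<q\le 6$, let $\mathbb T^3=([-1,1]|_{\{-1;1\}})^3$ be the flat torus, and let $$X=W^{1,q}(\mathbb T^3)\times W^{2,2}(\mathbb T^3)\times W^{2,2}(\mathbb T^3;\mathbb R^3),\qquad \|(\varrho,\vartheta,\mathbf u)\|_X=\|\varrho\|_{W^{1,q}}+\|\vartheta\|_{W^{2,2}}+\|\mathbf u\|_{W^{2,2}},$$ where $\|v\|_{W^{k,p}}=\big(\sum_{|\alpha|\le k}\|D^\alpha v\|_{L^p}^p\big)^{1/p}$. Put $$X^+=\{(\varrho,\vartheta,\mathbf u)\in X:\ \|\varrho^{-1}\|_{C(\mathbb T^3)}<\infty,\ \|\vartheta^{-1}\|_{C(\mathbb T^3)}<\infty\},\qquad X^+_\infty=X^+\cup\{\mathbf U_\infty\},\quad \mathbf U_\infty=(0,0,0),$$ where $\|f^{-1}\|_{C(\mathbb T^3)}=\sup_{\mathbb T^3}|f|^{-1}\in[0,\infty]$ is computed on the continuous representative of $f$ (with $1/0=\infty$). For $\mathbf U=(\varrho,\vartheta,\mathbf u)\in X^+$ write $S(\mathbf U)=\|\mathbf U\|_X+\|\varrho^{-1}\|_{C(\mathbb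 T^3)}+\|\vartheta^{-1}\|_{C(\mathbb T^3)}$, and let $G(\mathbf U)=(1+S(\mathbf U))^{-2}$ for $\mathbf U\in X^+$, $G(\mathbf U_\infty)=0$. Let $(e_{\mathbf k})_{\mathbf k\in\mathbb Z^5}$ be any orthonormal basis of $L^2(\mathbb T^3;\mathbb C^5)$ that consists of trigonometric polynomials (in particular, it may be a real one, i.e. an orthonormal basis of $L^2(\mathbb T^3;\mathbb R^5)$), and let $$F_{\mathbf k}(\mathbf U)=\int_{\mathbb T^3}\mathbf U\cdot e_{\mathbf k}\,dx,\qquad Q_{1,\mathbf k}=G,\qquad Q_{2,\mathbf k}=G\,F_{\mathbf k},$$ $$d(\mathbf U;\mathbf V)=\sum_{i=1,2,\ \mathbf k\in\mathbb Z^5}\exp(-|\mathbf k|)\,\frac{|Q_{i,\mathbf k}(\mathbf U)-Q_{i,\mathbf k}(\mathbf V)|}{1+|Q_{i,\mathbf k}(\mathbf U)-Q_{i,\mathbf k}(\mathbf V)|},$$ where $|\mathbf k|$ is the Euclidean length of $\mathbf k$. Let $\mathcal C$ be the class of functions $\mathcal F:X^+_\infty\to\mathbb R$ whose restriction to $X^+$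 is bounded and continuous (in the norm of $X$) and satisfies $\lim_{S(\mathbf U)\to\infty}\mathcal F|_{X^+}(\mathbf U)=\mathcal F(\mathbf U_\infty)$. Then: 1. The series defining $d$ converges, and $d$ is a metric on $X^+_\infty$. 2. $X^+_\infty$ with the topology induced by $d$ is a Polish space, i.e. it is separable and completely metrizable. 3. For $\mathbf U\in X^+$ and $\mathbf U_n\in X^+_\infty$: $d(\mathbf U_n;\mathbf U)\to0$ if and only if $\mathbf U_n\in X^+$ for all $n$ large enough and $\mathbf U_n\to\mathbf U$ in $X$. 4. For $\mathbf U_n\in X^+_\infty$: $d(\mathbf U_n;\mathbf U_\infty)\to0$ if and only if for every $M>0$ there is $n(M)$ such that for all $n\ge n(M)$ either $\mathbf U_n=\mathbf U_\infty$ or $S(\mathbf U_n)>M$. 5. $\mathcal C=BC(X^+_\infty)$, the space of bounded $d$-continuous real functions on $X^+_\infty$. -/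

import Mathlib

open MeasureTheory Filter Topology
open scoped ENNReal ContDiff

instance factZeroLtTwoReal : Fact ((0 : ℝ) < 2) := ⟨two_pos⟩

/-- The flat torus `(ℝ/2ℤ)³`, i.e. `[-1,1]³` with opposite faces identified. Its `volume` is
Lebesgue measure (total mass `8`). -/
abbrev T3 : Type := Fin 3 → AddCircle (2 : ℝ)

namespace T3

/-- The covering map `ℝ³ → 𝕋³`. -/
def proj (y : Fin 3 → ℝ) : T3 := fun j => (y j : AddCircle (2 : ℝ))

/-- A function on the torus is smooth when its periodic lift to `ℝ³` is `C^∞`. -/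
def Smooth (φ : T3 → ℝ) : Prop := ContDiff ℝ ∞ (φ ∘ proj)

/-- The partial derivative of a function on the torus in the `j`-th coordinate direction. -/
noncomputable def partialDeriv (j : Fin 3) (φ : T3 → ℝ) : T3 → ℝ :=
  fun x => deriv (fun t : ℝ => φ (x + Pi.single j (t : AddCircle (2 : ℝ)))) 0

/-- `D^α = ∂₀^α₀ ∂₁^α₁ ∂₂^α₂`. -/
noncomputable def multiDeriv (α : Fin 3 → ℕ) (φ : T3 → ℝ) : T3 → ℝ :=
  (partialDeriv 0)^[α 0] ((partialDeriv 1)^[α 1] ((partialDeriv 2)^[α 2] φ))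

theorem isOpenQuotientMap_proj : IsOpenQuotientMap proj :=
  IsOpenQuotientMap.piMap (fun _ : Fin 3 =>
    (QuotientAddGroup.isOpenQuotientMap_mk :
      IsOpenQuotientMap (fun a : ℝ => (a : AddCircle (2 : ℝ)))))

theorem Smooth.continuous {φ : T3 → ℝ} (h : Smooth φ) : Continuous φ :=
  isOpenQuotientMap_proj.isQuotientMap.continuous_iff.mpr (ContDiff.continuous h)

theorem Smooth.partialDeriv {φ : T3 → ℝ} (h : Smooth φ) (j : Fin 3) :
    Smooth (partialDeriv j φ) := by
  have key : T3.partialDeriv j φ ∘ proj =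
      fun y => fderiv ℝ (φ ∘ proj) y (Pi.single j (1 : ℝ)) := by
    funext y
    have hd : HasFDerivAt (φ ∘ proj) (fderiv ℝ (φ ∘ proj) y) (y + (0 : ℝ) • Pi.single j 1) := by
      simpa using ((ContDiff.differentiable h (by simp)) y).hasFDerivAt
    have hl : HasDerivAt (fun t : ℝ => y + t • (Pi.single j (1 : ℝ) : Fin 3 → ℝ))
        (Pi.single j (1 : ℝ)) 0 := by
      simpa using ((hasDerivAt_id (0 : ℝ)).smul_const
        (Pi.single j (1 : ℝ) : Fin 3 → ℝ)).const_add y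
    have hc := (hd.comp_hasDerivAt (0 : ℝ) hl).deriv
    rw [← hc]
    simp only [Function.comp_def, T3.partialDeriv]
    congr 1
    funext t
    congr 1
    funext i
    by_cases hi : i = j
    · subst hi; simp [proj]
    · simp [proj, hi]
  unfold Smooth
  rw [key]
  exact (ContDiff.fderiv_right (m := ∞) h (by simp)).clm_apply contDiff_const

theorem Smooth.iterate {φ : T3 → ℝ} (h : Smooth φ) (j : Fin 3) (n : ℕ) :
    Smooth ((T3.partialDeriv j)^[n] φ) := by
  induction n with
  | zero => exact h
  | succ n ih => rw [Function.iterate_succ_apply']; exact ih.partialDeriv j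

theorem Smooth.multiDeriv {φ : T3 → ℝ} (h : Smooth φ) (α : Fin 3 → ℕ) :
    Smooth (multiDeriv α φ) :=
  ((h.iterate 2 _).iterate 1 _).iterate 0 _

end T3

section Sobolev

/-- `w` is the weak derivative `D^α v` on the torus. -/
def IsWeakDeriv {E : Type*} [NormedAddCommGroup E] [NormedSpace ℝ E]
    (α : Fin 3 → ℕ) (v w : T3 → E) : Prop :=
  ∀ φ : T3 → ℝ, T3.Smooth φ →
    ∫ x, T3.multiDeriv α φ x • v x = (-1 : ℝ) ^ (∑ j, α j) • ∫ x, φ x • w x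

theorem integrable_smul_Lp {E : Type*} [NormedAddCommGroup E] [NormedSpace ℝ E]
    {p : ℝ≥0∞} [Fact (1 ≤ p)] {φ : T3 → ℝ} (hφ : Continuous φ)
    (v : Lp E p (volume : Measure T3)) : Integrable (fun x => φ x • v x) volume := by
  obtain ⟨C, hC⟩ := isCompact_univ.exists_bound_of_continuousOn (f := φ) hφ.continuousOn
  exact ((Lp.memLp v).integrable Fact.out).bdd_smul C hφ.aestronglyMeasurable
    (Eventually.of_forall fun x => hC x (Set.mem_univ x))

/-- Multi-indices `α ∈ ℕ³` with `|α| ≤ k`. -/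
abbrev MultiIdx (k : ℕ) : Type := {α : Fin 3 → Fin (k + 1) // ∑ j, (α j : ℕ) ≤ k}

/-- The multi-index `(0,0,0)`. -/
def MultiIdx.zero (k : ℕ) : MultiIdx k := ⟨0, by simp⟩

/-- The Sobolev space `W^{k,p}(𝕋³; E)`. An element is a function `v ∈ L^p` recorded together with
its (unique) weak derivatives `D^α v ∈ L^p`, `|α| ≤ k`; the norm that the ambient `ℓ^p` product of
`L^p` spaces induces is `(∑_{|α| ≤ k} ‖D^α v‖_{L^p}^p)^{1/p}`. -/
def Sobolev (k : ℕ) (p : ℝ≥0∞) [Fact (1 ≤ p)] (E : Type*) [NormedAddCommGroup E]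
    [NormedSpace ℝ E] :
    Submodule ℝ (PiLp p (fun _ : MultiIdx k => Lp E p (volume : Measure T3))) where
  carrier := {V | ∀ α : MultiIdx k,
    IsWeakDeriv (fun j => (α.1 j : ℕ)) (V (MultiIdx.zero k)) (V α)}
  zero_mem' := by
    intro α φ hφ
    have h0 : ((0 : Lp E p (volume : Measure T3)) : T3 → E) =ᵐ[volume] 0 := Lp.coeFn_zero _ _ _
    have h1 : ∀ ψ : T3 → ℝ,
        ∫ x, ψ x • ((0 : Lp E p (volume : Measure T3)) : T3 → E) x = 0 := by
      intro ψ
      refine integral_eq_zero_of_ae ?_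
      filter_upwards [h0] with x hx
      rw [hx, Pi.zero_apply, smul_zero]
    simp only [PiLp.zero_apply, h1, smul_zero]
  add_mem' := by
    intro V W hV hW α φ hφ
    have h1 : ∀ (ψ : T3 → ℝ), Continuous ψ → ∀ f g : Lp E p (volume : Measure T3),
        ∫ x, ψ x • ((f + g : Lp E p (volume : Measure T3)) : T3 → E) x =
          (∫ x, ψ x • f x) + ∫ x, ψ x • g x := by
      intro ψ hψ f g
      rw [← integral_add (integrable_smul_Lp hψ f) (integrable_smul_Lp hψ g)]
      refine integral_congr_ae ?_
      filter_upwards [Lp.coeFn_add f g] with x hx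
      rw [hx, Pi.add_apply, smul_add]
    simp only [PiLp.add_apply]
    rw [h1 _ (hφ.multiDeriv _).continuous, h1 _ hφ.continuous, hV α φ hφ, hW α φ hφ, smul_add]
  smul_mem' := by
    intro c V hV α φ hφ
    have h1 : ∀ (ψ : T3 → ℝ) (f : Lp E p (volume : Measure T3)),
        ∫ x, ψ x • ((c • f : Lp E p (volume : Measure T3)) : T3 → E) x =
          c • ∫ x, ψ x • f x := by
      intro ψ f
      rw [← integral_smul]
      refine integral_congr_ae ?_
      filter_upwards [Lp.coeFn_smul c f] with x hx
      rw [hx, Pi.smul_apply, smul_comm c]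
    simp only [PiLp.smul_apply]
    rw [h1, h1, hV α φ hφ, smul_comm c]

/-- The function underlying an element of `W^{k,p}`. -/
noncomputable def Sobolev.fn {k : ℕ} {p : ℝ≥0∞} [Fact (1 ≤ p)]
    {E : Type*} [NormedAddCommGroup E] [NormedSpace ℝ E] (v : Sobolev k p E) : T3 → E :=
  (v : PiLp p (fun _ : MultiIdx k => Lp E p (volume : Measure T3))) (MultiIdx.zero k)

end Sobolev

/-- `‖f⁻¹‖_{C(𝕋³)} = sup |f|⁻¹ ∈ [0,∞]`, computed on the continuous representative of `f`
(with `1/0 = ∞`; the value is `∞` if there is no continuous representative). -/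
noncomputable def invCNorm (f : T3 → ℝ) : ℝ≥0∞ :=
  ⨅ (w : C(T3, ℝ)) (_ : f =ᵐ[volume] w), ⨆ x, ‖w x‖ₑ⁻¹

/-- The phase space `X = W^{1,q}(𝕋³) × W^{2,2}(𝕋³) × W^{2,2}(𝕋³; ℝ³)` of triples `(ϱ, ϑ, u)`, with
the norm `‖(ϱ, ϑ, u)‖_X = ‖ϱ‖ + ‖ϑ‖ + ‖u‖`. -/
abbrev PhaseSpace (q : ℝ≥0∞) [Fact (1 ≤ q)] : Type :=
  WithLp 1 (Sobolev 1 q ℝ × WithLp 1 (Sobolev 2 2 ℝ × Sobolev 2 2 (EuclideanSpace ℝ (Fin 3))))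

namespace PhaseSpace

variable {q : ℝ≥0∞} [Fact (1 ≤ q)]

/-- The density `ϱ`. -/
noncomputable def density (U : PhaseSpace q) : T3 → ℝ := Sobolev.fn U.fst

/-- The temperature `ϑ`. -/
noncomputable def temperature (U : PhaseSpace q) : T3 → ℝ := Sobolev.fn U.snd.fst

/-- The velocity `u`. -/
noncomputable def velocity (U : PhaseSpace q) : T3 → EuclideanSpace ℝ (Fin 3) :=
  Sobolev.fn U.snd.snd

/-- The `ℝ⁵`-valued function `(ϱ, ϑ, u₁, u₂, u₃)`. -/
noncomputable def vec (U : PhaseSpace q) (x : T3) : Fin 5 → ℝ :=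
  ![U.density x, U.temperature x, U.velocity x 0, U.velocity x 1, U.velocity x 2]

/-- `‖U‖_X + ‖ϱ⁻¹‖_C + ‖ϑ⁻¹‖_C`; only used for `U ∈ X⁺`, where all three terms are finite. -/
noncomputable def size (U : PhaseSpace q) : ℝ :=
  ‖U‖ + (invCNorm U.density).toReal + (invCNorm U.temperature).toReal

end PhaseSpace

/-- `X⁺ = {(ϱ, ϑ, u) ∈ X : ‖ϱ⁻¹‖_C < ∞, ‖ϑ⁻¹‖_C < ∞}`. -/
def XPlus (q : ℝ≥0∞) [Fact (1 ≤ q)] : Set (PhaseSpace q) :=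
  {U | invCNorm U.density < ⊤ ∧ invCNorm U.temperature < ⊤}

/-- `X⁺_∞ = X⁺ ∪ {(0,0,0)}`, as a bare type: it carries no topology of its own. -/
def XPlusInf (q : ℝ≥0∞) [Fact (1 ≤ q)] : Type :=
  {U : PhaseSpace q // U ∈ XPlus q ∪ {0}}

namespace XPlusInf

variable {q : ℝ≥0∞} [Fact (1 ≤ q)]

/-- The underlying element of `X`. -/
noncomputable def toX (U : XPlusInf q) : PhaseSpace q := U.1

/-- The inclusion `X⁺ ⊆ X⁺_∞`. -/
noncomputable def ofPlus (U : XPlus q) : XPlusInf q := ⟨U.1, Or.inl U.2⟩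

/-- The point `U_∞ = (0,0,0)`. -/
noncomputable def infty (q : ℝ≥0∞) [Fact (1 ≤ q)] : XPlusInf q := ⟨0, Or.inr rfl⟩

open Classical in
/-- The weight `G`. -/
noncomputable def weight (U : XPlusInf q) : ℝ :=
  if U.toX ∈ XPlus q then ((1 + U.toX.size) ^ 2)⁻¹ else 0

/-- The class `𝒞`: functions that are bounded and continuous on `X⁺` (with the topology of `X`) and
tend to their value at `(0,0,0)` as `‖U‖_X + ‖ϱ⁻¹‖_C + ‖ϑ⁻¹‖_C → ∞`, `U ∈ X⁺`. -/
def classC (q : ℝ≥0∞) [Fact (1 ≤ q)] : Set (XPlusInf q → ℝ) :=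
  {F | Continuous (fun U : XPlus q => F (ofPlus U)) ∧
    (∃ C : ℝ, ∀ U : XPlus q, |F (ofPlus U)| ≤ C) ∧
    Tendsto (fun U : XPlus q => F (ofPlus U))
      (comap (fun U : XPlus q => (U : PhaseSpace q).size) atTop) (𝓝 (F (infty q)))}

end XPlusInf

/-- `L²(𝕋³; ℂ⁵)`. -/
abbrev L2C5 : Type := Lp (EuclideanSpace ℂ (Fin 5)) 2 (volume : Measure T3)

/-- `f` is a (vector-valued) trigonometric polynomial
`x ↦ ∑_{n ∈ s} exp(iπ n·x) c_n`, `s ⊆ ℤ³` finite, `c_n ∈ ℂ⁵`. -/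
def IsTrigPoly (f : T3 → EuclideanSpace ℂ (Fin 5)) : Prop :=
  ∃ (s : Finset (Fin 3 → ℤ)) (c : (Fin 3 → ℤ) → EuclideanSpace ℂ (Fin 5)),
    f =ᵐ[volume] fun x => ∑ n ∈ s, (∏ j, fourier (n j) (x j)) • c n

section Distance

variable {q : ℝ≥0∞} [Fact (1 ≤ q)] (e : HilbertBasis (Fin 5 → ℤ) ℂ L2C5)

/-- The Fourier coefficient `F_k(U) = ∫ U · e_k dx`. -/
noncomputable def fourierF (k : Fin 5 → ℤ) (U : PhaseSpace q) : ℂ :=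
  ∫ x, ∑ j, (U.vec x j : ℂ) * (e k : T3 → EuclideanSpace ℂ (Fin 5)) x j

/-- `Q_{1,k} = G` and `Q_{2,k} = G F_k`; the indices `1, 2` are `0, 1 : Fin 2`. -/
noncomputable def fourierQ (i : Fin 2) (k : Fin 5 → ℤ) (U : XPlusInf q) : ℂ :=
  if i = 0 then (U.weight : ℂ) else (U.weight : ℂ) * fourierF e k U.toX

/-- The summand of index `(i, k)` of `d(U; V)`; `|k|` is the Euclidean length. -/
noncomputable def phaseTerm (U V : XPlusInf q) (ik : Fin 2 × (Fin 5 → ℤ)) : ℝ :=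
  Real.exp (-Real.sqrt (∑ j, (ik.2 j : ℝ) ^ 2)) *
    (‖fourierQ e ik.1 ik.2 U - fourierQ e ik.1 ik.2 V‖ /
      (1 + ‖fourierQ e ik.1 ik.2 U - fourierQ e ik.1 ik.2 V‖))

/-- `d(U; V)`. -/
noncomputable def phaseDist (U V : XPlusInf q) : ℝ := ∑' ik, phaseTerm e U V ik

end Distance

/-!
Morrey's inequality embeds `W^{1,q}`, `q > 3`, and `W^{2,2}` into `C(𝕋³)`, so that `‖ϱ⁻¹‖_C` and
`‖ϑ⁻¹‖_C` are continuous on `X⁺` for the norm of `X`, and hence so is the size `S`.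

Conversely, suppose that all `Q_{i,k}` converge at a point of `X⁺`. Since `G` is a monotone function
of `S`, the sizes and the Fourier coefficients converge. Bounded sizes and convergent Fourier
coefficients give weak convergence in each factor of `X`; each summand of `S` is lower
semicontinuous under weak convergence, so convergence of the sum forces convergence of each summand,
and in the uniformly convex spaces `W^{1,q}` and `W^{2,2}` weak convergence and convergence of the
norms give strong convergence.

It follows that `U ↦ (G(U) U, G(U))` is a closed embedding of `X⁺_∞` into the Polish space `X × ℝ`:
where `G` stays away from `0` it can be inverted, and `G(U_n) → 0` means `U_n → U_∞`. Finally `X⁺`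
is an open subspace whose complement is `U_∞`, and the punctured neighbourhoods of `U_∞` are given
by `S → ∞`; this is the description of `BC(X⁺_∞)`.
-/

/-! ### Product kernels on the torus -/

/-- A smooth function on the line supported in `[-r, r]`. -/
structure IsBump (r : ℝ) (f : ℝ → ℝ) : Prop where
  contDiff : ContDiff ℝ ∞ f
  support_subset : Function.support f ⊆ Metric.closedBall 0 r

namespace IsBump

variable {r s : ℝ} {f : ℝ → ℝ}

theorem of_forall_lt_abs (hf : ContDiff ℝ ∞ f) (h : ∀ t, r < |t| → f t = 0) : IsBump r f :=
  ⟨hf, fun t ht => by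
    rw [mem_closedBall_zero_iff, Real.norm_eq_abs]
    exact not_lt.mp (mt (h t) ht)⟩

theorem eq_zero_of_lt_abs (h : IsBump r f) {t : ℝ} (ht : r < |t|) : f t = 0 := by
  by_contra hne
  exact ht.not_ge (mem_closedBall_zero_iff.mp (h.support_subset hne))

theorem deriv (h : IsBump r f) : IsBump r (deriv f) :=
  ⟨((contDiff_infty_iff_deriv (𝕜 := ℝ)).mp h.contDiff).2,
    support_deriv_subset.trans (closure_minimal h.support_subset Metric.isClosed_closedBall)⟩

theorem iteratedDeriv (h : IsBump r f) (n : ℕ) : IsBump r (iteratedDeriv n f) := by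
  induction n with
  | zero => simpa only [iteratedDeriv_zero] using h
  | succ n ih => rw [iteratedDeriv_succ]; exact ih.deriv

theorem mono (h : IsBump r f) (hrs : r ≤ s) : IsBump s f :=
  ⟨h.contDiff, h.support_subset.trans (Metric.closedBall_subset_closedBall hrs)⟩

theorem exists_abs_le (h : IsBump r f) : ∃ C, ∀ t, |f t| ≤ C :=
  h.contDiff.continuous.bounded_above_of_compact_support
    (HasCompactSupport.of_support_subset_isCompact (isCompact_closedBall 0 r) h.support_subset)

theorem scale (h : IsBump r f) (c : ℝ) {a : ℝ} (ha : 0 < a) :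
    IsBump (r / a) (fun t => c * f (a * t)) := by
  refine of_forall_lt_abs
    (contDiff_const.mul (h.contDiff.comp (contDiff_const.mul contDiff_id))) fun t ht => ?_
  rw [h.eq_zero_of_lt_abs, mul_zero]
  rwa [abs_mul, abs_of_pos ha, ← div_lt_iff₀' ha]

end IsBump

/-- The function on the circle `ℝ/2ℤ` that agrees with `f` on `(-1, 1]`. -/
noncomputable def circleLift (f : ℝ → ℝ) : AddCircle (2 : ℝ) → ℝ := AddCircle.liftIoc 2 (-1) f

section CircleLift

variable {f : ℝ → ℝ}

theorem circleLift_coe {t : ℝ} (ht : t ∈ Set.Ioc (-1 : ℝ) 1) :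
    circleLift f (t : AddCircle (2 : ℝ)) = f t :=
  AddCircle.liftIoc_coe_apply (by rwa [show (-1 : ℝ) + 2 = 1 by norm_num])

theorem exists_mem_Ioc_coe_eq (y : AddCircle (2 : ℝ)) :
    ∃ t ∈ Set.Ioc (-1 : ℝ) 1, (t : AddCircle (2 : ℝ)) = y := by
  have hy : y ∈ ((↑) : ℝ → AddCircle (2 : ℝ)) '' Set.Ioc (-1) (-1 + 2) := by
    rw [AddCircle.coe_image_Ioc_eq]; trivial
  rwa [show (-1 : ℝ) + 2 = 1 by norm_num] at hy

theorem circleLift_add (f g : ℝ → ℝ) (y : AddCircle (2 : ℝ)) :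
    circleLift (f + g) y = circleLift f y + circleLift g y := by
  obtain ⟨t, ht, rfl⟩ := exists_mem_Ioc_coe_eq y
  simp only [circleLift_coe ht, Pi.add_apply]

theorem abs_circleLift_le {C : ℝ} (hf : ∀ t, |f t| ≤ C) (y : AddCircle (2 : ℝ)) :
    |circleLift f y| ≤ C := by
  obtain ⟨t, ht, rfl⟩ := exists_mem_Ioc_coe_eq y
  rw [circleLift_coe ht]
  exact hf t

theorem IsBump.norm_le_of_circleLift_ne_zero {r : ℝ} (hf : IsBump r f) {y : AddCircle (2 : ℝ)}
    (hy : circleLift f y ≠ 0) : ‖y‖ ≤ r := by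
  obtain ⟨t, ht, rfl⟩ := exists_mem_Ioc_coe_eq y
  rw [circleLift_coe ht] at hy
  exact QuotientAddGroup.norm_mk_le_norm.trans
    (mem_closedBall_zero_iff.mp (hf.support_subset hy))

theorem IsBump.circleLift_coe_of_abs_lt (hf : IsBump (1 / 2) f) {t : ℝ} (ht : |t| < 3 / 2) :
    circleLift f (t : AddCircle (2 : ℝ)) = f t := by
  rw [abs_lt] at ht
  rcases le_or_gt t (-1) with hlow | hlow
  · rw [← AddCircle.coe_add_period, circleLift_coe ⟨by linarith, by linarith⟩,
      hf.eq_zero_of_lt_abs (lt_abs.mpr (.inl (by linarith))),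
      hf.eq_zero_of_lt_abs (lt_abs.mpr (.inr (by linarith)))]
  rcases le_or_gt t 1 with hupp | hupp
  · exact circleLift_coe ⟨hlow, hupp⟩
  · rw [← sub_zero (t : AddCircle (2 : ℝ)), ← AddCircle.coe_period, ← AddCircle.coe_sub,
      circleLift_coe ⟨by linarith, by linarith⟩,
      hf.eq_zero_of_lt_abs (lt_abs.mpr (.inr (by linarith))),
      hf.eq_zero_of_lt_abs (lt_abs.mpr (.inl (by linarith)))]

theorem IsBump.circleLift_coe_add_eventuallyEq (hf : IsBump (1 / 2) f) {s : ℝ}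
    (hs : s ∈ Set.Ioc (-1 : ℝ) 1) :
    (fun t : ℝ => circleLift f ((s : AddCircle (2 : ℝ)) + t)) =ᶠ[𝓝 0] fun t => f (s + t) := by
  have hnear : ∀ᶠ t : ℝ in 𝓝 0, |s + t| < 3 / 2 := by
    refine ContinuousAt.eventually_lt (by fun_prop) continuousAt_const ?_
    rw [add_zero, abs_lt]
    constructor <;> linarith [hs.1, hs.2]
  filter_upwards [hnear] with t ht
  rw [← AddCircle.coe_add, hf.circleLift_coe_of_abs_lt ht]

theorem IsBump.contDiff_circleLift (hf : IsBump (1 / 2) f) (y : AddCircle (2 : ℝ)) :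
    ContDiff ℝ ∞ (fun t : ℝ => circleLift f (y + t)) := by
  rw [contDiff_iff_contDiffAt]
  intro t₀
  obtain ⟨s, hs, hst⟩ := exists_mem_Ioc_coe_eq (y + t₀)
  have hsmooth : ContDiffAt ℝ ∞ (fun t : ℝ => circleLift f ((s : AddCircle (2 : ℝ)) + t)) 0 :=
    (hf.contDiff.comp (contDiff_const.add contDiff_id)).contDiffAt.congr_of_eventuallyEq
      (hf.circleLift_coe_add_eventuallyEq hs)
  have htranslate : (fun t : ℝ => circleLift f (y + t)) =
      (fun t : ℝ => circleLift f ((s : AddCircle (2 : ℝ)) + t)) ∘ fun t => t - t₀ := by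
    funext t
    simp only [Function.comp_apply, hst, AddCircle.coe_sub]
    abel_nf
  rw [htranslate]
  exact ContDiffAt.comp t₀ (by simpa using hsmooth) (contDiffAt_id.sub contDiffAt_const)

theorem IsBump.deriv_circleLift (hf : IsBump (1 / 2) f) (y : AddCircle (2 : ℝ)) :
    _root_.deriv (fun t : ℝ => circleLift f (y + t)) 0 = circleLift (_root_.deriv f) y := by
  obtain ⟨s, hs, rfl⟩ := exists_mem_Ioc_coe_eq y
  rw [(hf.circleLift_coe_add_eventuallyEq hs).deriv_eq, deriv_comp_const_add, add_zero,
    circleLift_coe hs]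

end CircleLift

namespace T3

/-- The product kernel `y ↦ ∏ j, f_j (y_j - x_j)` on the torus; the `f_j` are meant to be supported
in `(-1, 1)`. -/
noncomputable def kernel (x : T3) (f : Fin 3 → ℝ → ℝ) (y : T3) : ℝ :=
  ∏ j, circleLift (f j) (y j - x j)

section Kernel

variable (x : T3) {f : Fin 3 → ℝ → ℝ}

theorem smooth_kernel (hf : ∀ j, IsBump (1 / 2) (f j)) : Smooth (kernel x f) := by
  have hlift : kernel x f ∘ proj = fun z => ∏ j, circleLift (f j) (-x j + (z j : ℝ)) := by
    funext z
    simp only [Function.comp_apply, kernel, proj, sub_eq_neg_add]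
  rw [Smooth, hlift]
  exact contDiff_prod fun j _ =>
    ((hf j).contDiff_circleLift (-x j)).comp (contDiff_apply ℝ ℝ j)

theorem partialDeriv_kernel {j : Fin 3} (hf : IsBump (1 / 2) (f j)) :
    partialDeriv j (kernel x f) = kernel x (Function.update f j (deriv (f j))) := by
  funext y
  have hfactor : ∀ t : ℝ, kernel x f (y + Pi.single j (t : AddCircle (2 : ℝ))) =
      circleLift (f j) (y j - x j + t) *
        ∏ i ∈ Finset.univ.erase j, circleLift (f i) (y i - x i) := by
    intro t
    rw [kernel, ← Finset.mul_prod_erase _ _ (Finset.mem_univ j)]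
    congr 1
    · rw [Pi.add_apply, Pi.single_eq_same, add_sub_right_comm]
    · refine Finset.prod_congr rfl fun i hi => ?_
      rw [Pi.add_apply, Pi.single_eq_of_ne (Finset.ne_of_mem_erase hi), add_zero]
  have hdiff : DifferentiableAt ℝ (fun t : ℝ => circleLift (f j) (y j - x j + t)) 0 :=
    (hf.contDiff_circleLift _).differentiable (by simp) _
  simp only [partialDeriv, hfactor]
  rw [deriv_mul_const hdiff, hf.deriv_circleLift, kernel,
    ← Finset.mul_prod_erase _ _ (Finset.mem_univ j), Function.update_self]
  congr 1
  refine Finset.prod_congr rfl fun i hi => ?_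
  rw [Function.update_of_ne (Finset.ne_of_mem_erase hi)]

theorem iterate_partialDeriv_kernel {j : Fin 3} (hf : IsBump (1 / 2) (f j)) (n : ℕ) :
    (partialDeriv j)^[n] (kernel x f) =
      kernel x (Function.update f j (iteratedDeriv n (f j))) := by
  induction n with
  | zero => simp
  | succ n ih =>
    rw [Function.iterate_succ_apply', ih, partialDeriv_kernel, Function.update_idem,
      Function.update_self, iteratedDeriv_succ]
    rw [Function.update_self]
    exact hf.iteratedDeriv n

theorem abs_kernel_le {C : Fin 3 → ℝ} (hC : ∀ j t, |f j t| ≤ C j) (y : T3) :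
    |kernel x f y| ≤ ∏ j, C j := by
  rw [kernel, Finset.abs_prod]
  exact Finset.prod_le_prod (fun _ _ => abs_nonneg _) fun j _ => abs_circleLift_le (hC j) _

theorem support_kernel_subset {r : ℝ} (hf : ∀ j, IsBump r (f j)) :
    Function.support (kernel x f) ⊆ Metric.closedBall x r := by
  intro y hy
  have hcoord : ∀ j, ‖y j - x j‖ ≤ r := fun j =>
    (hf j).norm_le_of_circleLift_ne_zero (Finset.prod_ne_zero_iff.mp hy j (Finset.mem_univ j))
  rw [mem_closedBall_iff_norm, pi_norm_le_iff_of_nonneg ((norm_nonneg _).trans (hcoord 0))]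
  exact hcoord

theorem integral_kernel : ∫ y, kernel x f y = ∏ j, ∫ t in (-1 : ℝ)..1, f j t := by
  simp only [kernel]
  rw [integral_fintype_prod_volume_eq_prod
    (fun j (t : AddCircle (2 : ℝ)) => circleLift (f j) (t - x j))]
  refine Finset.prod_congr rfl fun j _ => ?_
  rw [integral_sub_right_eq_self (fun t => circleLift (f j) t), circleLift,
    AddCircle.integral_liftIoc_eq_intervalIntegral]
  norm_num

/-- The factors `b, …, b, c, a, …, a` with `c` in position `j`, which occur in the telescoping
expansion of a difference of two products. -/
def telescopeFactors (a b c : ℝ → ℝ) (j i : Fin 3) : ℝ → ℝ :=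
  if i < j then b else if i = j then c else a

theorem forall_telescopeFactors {P : (ℝ → ℝ) → Prop} {a b c : ℝ → ℝ} (ha : P a) (hb : P b)
    (hc : P c) (j i : Fin 3) : P (telescopeFactors a b c j i) := by
  unfold telescopeFactors
  split_ifs <;> assumption

theorem telescopeFactors_self (a b c : ℝ → ℝ) (j : Fin 3) :
    telescopeFactors a b c j j = c := by
  simp only [telescopeFactors, lt_irrefl, if_false, if_true]

theorem update_telescopeFactors (a b c d : ℝ → ℝ) (j : Fin 3) :
    Function.update (telescopeFactors a b c j) j d = telescopeFactors a b d j := by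
  funext i
  rcases eq_or_ne i j with rfl | hij
  · rw [Function.update_self, telescopeFactors_self]
  · simp only [Function.update_of_ne hij, telescopeFactors, if_neg hij]

theorem kernel_sub_kernel (a b : ℝ → ℝ) (y : T3) :
    kernel x (fun _ => b) y - kernel x (fun _ => a) y =
      ∑ j, kernel x (telescopeFactors a b (b - a) j) y := by
  have hsub : ∀ z, circleLift (b - a) z = circleLift b z - circleLift a z := fun z => by
    rw [eq_sub_iff_add_eq, ← circleLift_add, sub_add_cancel]
  have hfactor : ∀ j i, circleLift (telescopeFactors a b (b - a) j i) (y i - x i) =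
      if i < j then circleLift b (y i - x i) else
        if i = j then circleLift b (y i - x i) - circleLift a (y i - x i) else
          circleLift a (y i - x i) := fun j i => by
    rw [← hsub, telescopeFactors]
    split_ifs <;> rfl
  simp only [kernel, hfactor, Fin.sum_univ_three, Fin.prod_univ_three, Fin.isValue, Fin.reduceLT,
    Fin.reduceEq, if_true, if_false]
  ring

end Kernel

theorem volume_closedBall_le (x : T3) {r : ℝ} (hr : 0 ≤ r) :
    volume (Metric.closedBall x r) ≤ ENNReal.ofReal ((2 * r) ^ 3) := by
  rw [closedBall_pi _ hr, volume_pi_pi]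
  simp only [AddCircle.volume_closedBall]
  rw [Finset.prod_const, Finset.card_univ, Fintype.card_fin, ENNReal.ofReal_pow (by positivity)]
  gcongr
  exact min_le_right _ _

end T3

/-! ### Morrey's inequality -/

theorem one_sub_one_div_toReal_nonneg (p : ℝ≥0∞) [hp : Fact (1 ≤ p)] : 0 ≤ 1 - 1 / p.toReal := by
  rcases eq_or_ne p ⊤ with rfl | hp_top
  · simp
  · have hp_one : 1 ≤ p.toReal :=
      (ENNReal.ofReal_le_iff_le_toReal hp_top).mp (by simpa using hp.out)
    rw [sub_nonneg, div_le_one (by linarith)]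
    exact hp_one

theorem setIntegral_norm_le_measureReal_rpow_mul_norm {Ω E : Type*} [MeasurableSpace Ω]
    {μ : Measure Ω} [NormedAddCommGroup E] {p : ℝ≥0∞} [Fact (1 ≤ p)] (v : Lp E p μ) {s : Set Ω}
    (hs : μ s ≠ ⊤) : ∫ y in s, ‖v y‖ ∂μ ≤ μ.real s ^ (1 - 1 / p.toReal) * ‖v‖ := by
  have hmeas : AEStronglyMeasurable v (μ.restrict s) := (Lp.aestronglyMeasurable v).restrict
  have hpow : μ s ^ (1 - 1 / p.toReal) ≠ ⊤ :=
    ENNReal.rpow_ne_top_of_nonneg (one_sub_one_div_toReal_nonneg p) hs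
  have hhoelder : eLpNorm v 1 (μ.restrict s) ≤ eLpNorm v p μ * μ s ^ (1 - 1 / p.toReal) := by
    refine (eLpNorm_le_eLpNorm_mul_rpow_measure_univ (Fact.out : 1 ≤ p) hmeas).trans ?_
    rw [Measure.restrict_apply_univ, ENNReal.toReal_one, div_one]
    gcongr
    exact Measure.restrict_le_self
  rw [integral_norm_eq_lintegral_enorm hmeas, ← eLpNorm_one_eq_lintegral_enorm]
  refine (ENNReal.toReal_mono (ENNReal.mul_ne_top (Lp.eLpNorm_ne_top v) hpow)
    hhoelder).trans_eq ?_
  rw [ENNReal.toReal_mul, ← ENNReal.toReal_rpow, ← Lp.norm_def, mul_comm, Measure.real]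

section Mollifier

/-- A smooth function that vanishes on `(-∞, -1/2]` and equals `tⁿ / n!` on `[0, ∞)`. -/
noncomputable def powRamp (n : ℕ) (t : ℝ) : ℝ :=
  t ^ n / n.factorial * Real.smoothTransition (2 * t + 1)

theorem contDiff_powRamp (n : ℕ) : ContDiff ℝ ∞ (powRamp n) :=
  ((contDiff_id.pow n).div_const _).mul (Real.smoothTransition.contDiff.comp
    ((contDiff_const.mul contDiff_id).add contDiff_const))

theorem powRamp_of_le (n : ℕ) {t : ℝ} (ht : t ≤ -1 / 2) : powRamp n t = 0 := by
  rw [powRamp, Real.smoothTransition.zero_of_nonpos (by linarith), mul_zero]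

theorem powRamp_of_nonneg (n : ℕ) {t : ℝ} (ht : 0 ≤ t) : powRamp n t = t ^ n / n.factorial := by
  rw [powRamp, Real.smoothTransition.one_of_one_le (by linarith), mul_one]

theorem iteratedDeriv_powRamp_of_lt (n i : ℕ) {t : ℝ} (ht : t < -1 / 2) :
    iteratedDeriv i (powRamp n) t = 0 := by
  have hzero : powRamp n =ᶠ[𝓝 t] fun _ => 0 := by
    filter_upwards [Iio_mem_nhds ht] with s hs using powRamp_of_le n hs.le
  rw [hzero.iteratedDeriv_eq, iteratedDeriv_const]
  split_ifs <;> rfl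

theorem iteratedDeriv_powRamp_of_pos (n i : ℕ) {t : ℝ} (ht : 0 < t) :
    iteratedDeriv i (powRamp n) t = n.descFactorial i * t ^ (n - i) / n.factorial := by
  have hpow : powRamp n =ᶠ[𝓝 t] fun s => s ^ n / n.factorial := by
    filter_upwards [Ioi_mem_nhds ht] with s hs using powRamp_of_nonneg n hs.le
  rw [hpow.iteratedDeriv_eq]
  simp only [div_eq_inv_mul, iteratedDeriv_const_mul_field, iteratedDeriv_pow]

/-- A smooth function of integral one supported in `[-1/2, 0]`. It is an `(n+1)`-st derivative, and
so is the difference between it and its rescaling by `2`, see `iteratedDeriv_powRampDiff`. -/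
noncomputable def mollifier (n : ℕ) : ℝ → ℝ := iteratedDeriv (n + 1) (powRamp n)

theorem isBump_mollifier (n : ℕ) : IsBump (1 / 2) (mollifier n) := by
  refine .of_forall_lt_abs ?_ fun t ht => ?_
  · rw [mollifier, iteratedDeriv_eq_iterate]
    exact (contDiff_powRamp n).iterate_deriv _
  · rcases lt_abs.mp ht with hpos | hneg
    · rw [mollifier, iteratedDeriv_powRamp_of_pos n _ (by linarith),
        Nat.descFactorial_of_lt n.lt_succ_self, Nat.cast_zero, zero_mul, zero_div]
    · exact iteratedDeriv_powRamp_of_lt n _ (by linarith)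

/-- The mollifier at scale `2^{-m}`. -/
noncomputable def scaledMollifier (n m : ℕ) (t : ℝ) : ℝ := 2 ^ m * mollifier n (2 ^ m * t)

theorem isBump_scaledMollifier (n m : ℕ) : IsBump (1 / 2 / 2 ^ m) (scaledMollifier n m) :=
  (isBump_mollifier n).scale _ (by positivity)

theorem one_half_div_two_pow_le (m : ℕ) : (1 : ℝ) / 2 / 2 ^ m ≤ 1 / 2 :=
  div_le_self (by norm_num) (one_le_pow₀ one_le_two)

theorem exists_abs_scaledMollifier_le (n : ℕ) :
    ∃ C, ∀ m t, |scaledMollifier n m t| ≤ C * 2 ^ m := by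
  obtain ⟨C, hC⟩ := (isBump_mollifier n).exists_abs_le
  refine ⟨C, fun m t => ?_⟩
  rw [scaledMollifier, abs_mul, abs_of_pos (by positivity), mul_comm]
  gcongr
  exact hC _

theorem integral_scaledMollifier (n m : ℕ) : ∫ t in (-1 : ℝ)..1, scaledMollifier n m t = 1 := by
  have hderiv : ∀ t, HasDerivAt (fun t : ℝ => iteratedDeriv n (powRamp n) (2 ^ m * t))
      (scaledMollifier n m t) t := by
    intro t
    have houter : HasDerivAt (iteratedDeriv n (powRamp n)) (mollifier n (2 ^ m * t))
        (2 ^ m * t) := by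
      rw [mollifier, iteratedDeriv_succ]
      exact ((contDiff_powRamp n).differentiable_iteratedDeriv n
        (by exact_mod_cast ENat.natCast_lt_top n) _).hasDerivAt
    have hinner : HasDerivAt (fun t : ℝ => 2 ^ m * t) (2 ^ m) t := by
      simpa using (hasDerivAt_id t).const_mul (2 ^ m : ℝ)
    have hcomp := houter.comp t hinner
    rwa [mul_comm] at hcomp
  have hscale : (1 : ℝ) ≤ 2 ^ m := one_le_pow₀ one_le_two
  rw [intervalIntegral.integral_eq_sub_of_hasDerivAt (fun t _ => hderiv t)
      ((isBump_scaledMollifier n m).contDiff.continuous.intervalIntegrable _ _),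
    iteratedDeriv_powRamp_of_pos n n (by linarith), iteratedDeriv_powRamp_of_lt n n (by linarith),
    Nat.descFactorial_self, Nat.sub_self, pow_zero, mul_one, sub_zero,
    div_self (Nat.cast_ne_zero.mpr n.factorial_ne_zero)]

/-- A bump function whose `(n+1)`-st derivative is `2 κ(2·) - κ`, where `κ = mollifier n`: since
`tⁿ` is homogeneous, the two terms cancel on `[0, ∞)`. -/
noncomputable def powRampDiff (n : ℕ) (t : ℝ) : ℝ := (2 ^ n)⁻¹ * powRamp n (2 * t) - powRamp n t

theorem isBump_powRampDiff (n : ℕ) : IsBump (1 / 2) (powRampDiff n) := by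
  refine .of_forall_lt_abs ((contDiff_const.mul ((contDiff_powRamp n).comp
    (contDiff_const.mul contDiff_id))).sub (contDiff_powRamp n)) fun t ht => ?_
  rcases lt_abs.mp ht with hpos | hneg
  · rw [powRampDiff, powRamp_of_nonneg n (by linarith), powRamp_of_nonneg n (by linarith), mul_pow]
    field_simp
    ring
  · rw [powRampDiff, powRamp_of_le n (by linarith), powRamp_of_le n (by linarith)]
    ring

theorem iteratedDeriv_powRampDiff (n : ℕ) (t : ℝ) :
    iteratedDeriv (n + 1) (powRampDiff n) t = 2 * mollifier n (2 * t) - mollifier n t := by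
  have hramp : ContDiff ℝ (n + 1 : ℕ) (powRamp n) := contDiff_infty.mp (contDiff_powRamp n) _
  have hscaled : ContDiff ℝ (n + 1 : ℕ) (fun t : ℝ => powRamp n (2 * t)) :=
    hramp.comp (contDiff_const.mul contDiff_id)
  change iteratedDeriv (n + 1) ((fun t => (2 ^ n)⁻¹ * powRamp n (2 * t)) - powRamp n) t = _
  rw [iteratedDeriv_sub (contDiff_const.mul hscaled).contDiffAt hramp.contDiffAt,
    iteratedDeriv_const_mul_field, iteratedDeriv_comp_const_mul hramp, mollifier, pow_succ]
  field_simp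

/-- A bump function whose `(n+1)`-st derivative is the difference of the mollifiers at the scales
`2^{-(m+1)}` and `2^{-m}`. -/
noncomputable def mollifierDiffPrimitive (n m : ℕ) (t : ℝ) : ℝ :=
  ((2 ^ m) ^ n)⁻¹ * powRampDiff n (2 ^ m * t)

theorem isBump_mollifierDiffPrimitive (n m : ℕ) :
    IsBump (1 / 2 / 2 ^ m) (mollifierDiffPrimitive n m) :=
  (isBump_powRampDiff n).scale _ (by positivity)

theorem exists_abs_mollifierDiffPrimitive_le (n : ℕ) :
    ∃ C, ∀ m t, |mollifierDiffPrimitive n m t| ≤ C * ((2 ^ m) ^ n)⁻¹ := by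
  obtain ⟨C, hC⟩ := (isBump_powRampDiff n).exists_abs_le
  refine ⟨C, fun m t => ?_⟩
  rw [mollifierDiffPrimitive, abs_mul, abs_of_pos (by positivity), mul_comm]
  gcongr
  exact hC _

theorem iteratedDeriv_mollifierDiffPrimitive (n m : ℕ) :
    iteratedDeriv (n + 1) (mollifierDiffPrimitive n m) =
      scaledMollifier n (m + 1) - scaledMollifier n m := by
  have hsmooth : ContDiff ℝ (n + 1 : ℕ) (powRampDiff n) :=
    contDiff_infty.mp (isBump_powRampDiff n).contDiff _
  funext t
  change iteratedDeriv (n + 1)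
    (fun t => ((2 ^ m) ^ n)⁻¹ * powRampDiff n (2 ^ m * t)) t = _
  rw [iteratedDeriv_const_mul_field, iteratedDeriv_comp_const_mul hsmooth]
  simp only [iteratedDeriv_powRampDiff, scaledMollifier, Pi.sub_apply, pow_succ, ← mul_assoc,
    mul_comm (2 : ℝ)]
  field_simp

end Mollifier

theorem T3.abs_kernel_telescopeFactors_le (x : T3) {a b c : ℝ → ℝ} {A C : ℝ} (ha : ∀ t, |a t| ≤ A)
    (hb : ∀ t, |b t| ≤ A) (hc : ∀ t, |c t| ≤ C) (j : Fin 3) (y : T3) :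
    |T3.kernel x (T3.telescopeFactors a b c j) y| ≤ C * A ^ 2 := by
  have hfactor : ∀ i t, |T3.telescopeFactors a b c j i t| ≤ Function.update (fun _ => A) j C i := by
    intro i t
    rcases eq_or_ne i j with rfl | hij
    · rw [T3.telescopeFactors_self, Function.update_self]
      exact hc t
    · rw [Function.update_of_ne hij, T3.telescopeFactors, if_neg hij]
      split_ifs
      exacts [hb t, ha t]
  refine (T3.abs_kernel_le x hfactor y).trans_eq ?_
  rw [Finset.prod_update_of_mem (Finset.mem_univ j), Finset.prod_const,
    Finset.card_sdiff_of_subset (Finset.subset_univ _)]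
  simp

/-- The multi-index `k e_j`. -/
def MultiIdx.single (k : ℕ) (j : Fin 3) : MultiIdx k :=
  ⟨Pi.single j (Fin.last k), by simp [Pi.single_apply, apply_ite Fin.val]⟩

theorem MultiIdx.coe_single (k : ℕ) (j i : Fin 3) :
    ((MultiIdx.single k j).1 i : ℕ) = if i = j then k else 0 := by
  simp [MultiIdx.single, Pi.single_apply, apply_ite Fin.val]

theorem T3.multiDeriv_single (k : ℕ) (j : Fin 3) (φ : T3 → ℝ) :
    T3.multiDeriv (fun i => ((MultiIdx.single k j).1 i : ℕ)) φ = (T3.partialDeriv j)^[k] φ := by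
  fin_cases j <;> simp [T3.multiDeriv, MultiIdx.coe_single]

section Morrey

variable {p : ℝ≥0∞} [Fact (1 ≤ p)] {E : Type*} [NormedAddCommGroup E] [NormedSpace ℝ E]

theorem T3.norm_integral_kernel_smul_le (v : Lp E p (volume : Measure T3)) (x : T3)
    {f : Fin 3 → ℝ → ℝ} {r : ℝ} (hr : 0 ≤ r) (hf : ∀ j, IsBump r (f j)) {C : ℝ}
    (hC : ∀ y, |T3.kernel x f y| ≤ C) :
    ‖∫ y, T3.kernel x f y • v y‖ ≤ C * (((2 * r) ^ 3) ^ (1 - 1 / p.toReal) * ‖v‖) := by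
  have hC_nonneg : 0 ≤ C := (abs_nonneg _).trans (hC x)
  have hexp : 0 ≤ 1 - 1 / p.toReal := one_sub_one_div_toReal_nonneg p
  have h_int : Integrable v volume := (Lp.memLp v).integrable Fact.out
  rw [← setIntegral_eq_integral_of_forall_compl_eq_zero (s := Metric.closedBall x r) fun y hy => by
    rw [Function.notMem_support.mp (mt (T3.support_kernel_subset x hf ·) hy), zero_smul]]
  calc ‖∫ y in Metric.closedBall x r, T3.kernel x f y • v y‖
      ≤ ∫ y in Metric.closedBall x r, C * ‖v y‖ := by
        refine norm_integral_le_of_norm_le (h_int.norm.const_mul C).integrableOn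
          (Eventually.of_forall fun y => ?_)
        rw [norm_smul, Real.norm_eq_abs]
        gcongr
        exact hC y
    _ = C * ∫ y in Metric.closedBall x r, ‖v y‖ := integral_const_mul _ _
    _ ≤ C * (volume.real (Metric.closedBall x r) ^ (1 - 1 / p.toReal) * ‖v‖) := by
        gcongr
        exact setIntegral_norm_le_measureReal_rpow_mul_norm v (measure_ne_top _ _)
    _ ≤ C * (((2 * r) ^ 3) ^ (1 - 1 / p.toReal) * ‖v‖) := by
        gcongr
        exact ENNReal.toReal_le_of_le_ofReal (by positivity) (T3.volume_closedBall_le x hr)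

theorem T3.integrable_kernel_smul (v : Lp E p (volume : Measure T3)) (x : T3)
    {f : Fin 3 → ℝ → ℝ} (hf : ∀ j, IsBump (1 / 2) (f j)) :
    Integrable (fun y => T3.kernel x f y • v y) volume :=
  integrable_smul_Lp (T3.smooth_kernel x hf).continuous v

theorem Sobolev.norm_apply_le {k : ℕ} (v : Sobolev k p E) (α : MultiIdx k) : ‖v.1 α‖ ≤ ‖v‖ :=
  PiLp.norm_apply_le v.1 α

theorem Sobolev.integral_kernel_update {k : ℕ} (v : Sobolev k p E) (x : T3) {f : Fin 3 → ℝ → ℝ}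
    (hf : ∀ j, IsBump (1 / 2) (f j)) (j : Fin 3) :
    ∫ y, T3.kernel x (Function.update f j (iteratedDeriv k (f j))) y • Sobolev.fn v y =
      (-1 : ℝ) ^ k • ∫ y, T3.kernel x f y • v.1 (MultiIdx.single k j) y := by
  have hweak := v.2 (MultiIdx.single k j) _ (T3.smooth_kernel x hf)
  rwa [T3.multiDeriv_single, T3.iterate_partialDeriv_kernel x (hf j),
    show ∑ i, ((MultiIdx.single k j).1 i : ℕ) = k by simp [MultiIdx.coe_single]] at hweak

/-- The convolution of `g` with the product mollifier at scale `2^{-m}`. -/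
noncomputable def mollify (n m : ℕ) (g : T3 → E) (x : T3) : E :=
  ∫ y, T3.kernel x (fun _ => scaledMollifier n m) y • g y

theorem mollify_congr_ae (n m : ℕ) {g h : T3 → E} (hgh : g =ᵐ[volume] h) :
    mollify n m g = mollify n m h := by
  funext x
  refine integral_congr_ae ?_
  filter_upwards [hgh] with y hy
  rw [hy]

theorem isBump_scaledMollifier_succ (n m : ℕ) :
    IsBump (1 / 2 / 2 ^ m) (scaledMollifier n (m + 1)) :=
  (isBump_scaledMollifier n (m + 1)).mono (by gcongr <;> norm_num)

theorem Sobolev.mollify_succ_sub_mollify {n : ℕ} (v : Sobolev (n + 1) p E) (m : ℕ) (x : T3) :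
    mollify n (m + 1) (Sobolev.fn v) x - mollify n m (Sobolev.fn v) x =
      ∑ j, (-1 : ℝ) ^ (n + 1) • ∫ y, T3.kernel x (T3.telescopeFactors (scaledMollifier n m)
        (scaledMollifier n (m + 1)) (mollifierDiffPrimitive n m) j) y •
          v.1 (MultiIdx.single (n + 1) j) y := by
  have hr := one_half_div_two_pow_le m
  have hκ := (isBump_scaledMollifier n m).mono hr
  have hκ' := (isBump_scaledMollifier_succ n m).mono hr
  have hz := (isBump_mollifierDiffPrimitive n m).mono hr
  have hd := hz.iteratedDeriv (n + 1)
  rw [iteratedDeriv_mollifierDiffPrimitive] at hd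
  have h_int : ∀ f : Fin 3 → ℝ → ℝ, (∀ j, IsBump (1 / 2) (f j)) →
      Integrable (fun y => T3.kernel x f y • Sobolev.fn v y) volume := fun _ hf =>
    T3.integrable_kernel_smul _ x hf
  rw [mollify, mollify, ← integral_sub (h_int _ fun _ => hκ') (h_int _ fun _ => hκ)]
  simp only [← sub_smul, T3.kernel_sub_kernel, Finset.sum_smul]
  rw [integral_finsetSum _ fun j _ => h_int _ (T3.forall_telescopeFactors hκ hκ' hd j)]
  refine Finset.sum_congr rfl fun j _ => ?_
  rw [← Sobolev.integral_kernel_update v x (T3.forall_telescopeFactors hκ hκ' hz j) j,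
    T3.telescopeFactors_self, T3.update_telescopeFactors, iteratedDeriv_mollifierDiffPrimitive]

theorem two_pow_sq_mul_inv_mul_rpow (n m : ℕ) (P : ℝ) :
    ((2 : ℝ) ^ m) ^ 2 * ((2 ^ m) ^ n)⁻¹ * ((2 * (1 / 2 / 2 ^ m)) ^ 3) ^ (1 - 1 / P) =
      (2 ^ (3 / P - (n + 1 : ℕ))) ^ m := by
  have hpow : ∀ i : ℕ, ((2 : ℝ) ^ m) ^ i = 2 ^ ((m : ℝ) * i) := fun i => by
    rw [Real.rpow_mul two_pos.le, Real.rpow_natCast, Real.rpow_natCast]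
  have hradius : (2 * (1 / 2 / 2 ^ m : ℝ)) = 2 ^ (-(m : ℝ)) := by
    rw [Real.rpow_neg two_pos.le, Real.rpow_natCast]
    field_simp
  rw [hradius, hpow, hpow, ← Real.rpow_natCast _ 3, ← Real.rpow_mul two_pos.le,
    ← Real.rpow_mul two_pos.le, ← Real.rpow_neg two_pos.le, ← Real.rpow_add two_pos,
    ← Real.rpow_add two_pos, ← Real.rpow_natCast _ m, ← Real.rpow_mul two_pos.le]
  congr 1
  push_cast
  ring

theorem Sobolev.exists_norm_mollify_succ_sub_le (n : ℕ) :
    ∃ C, 0 ≤ C ∧ ∀ (v : Sobolev (n + 1) p E) (m : ℕ) (x : T3),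
      ‖mollify n (m + 1) (Sobolev.fn v) x - mollify n m (Sobolev.fn v) x‖ ≤
        C * ‖v‖ * (2 ^ (3 / p.toReal - (n + 1 : ℕ))) ^ m := by
  obtain ⟨A, hA⟩ := exists_abs_scaledMollifier_le n
  obtain ⟨B, hB⟩ := exists_abs_mollifierDiffPrimitive_le n
  have hA_nonneg : 0 ≤ A := by simpa using (abs_nonneg _).trans (hA 0 0)
  have hB_nonneg : 0 ≤ B := by simpa using (abs_nonneg _).trans (hB 0 0)
  refine ⟨3 * (B * (2 * A) ^ 2), by positivity, fun v m x => ?_⟩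
  have hκ : ∀ t, |scaledMollifier n m t| ≤ 2 * A * 2 ^ m := fun t => (hA m t).trans (by
    gcongr
    linarith)
  have hκ' : ∀ t, |scaledMollifier n (m + 1) t| ≤ 2 * A * 2 ^ m := fun t =>
    (hA (m + 1) t).trans_eq (by ring)
  have hterm : ∀ j, ‖(-1 : ℝ) ^ (n + 1) • ∫ y, T3.kernel x (T3.telescopeFactors
      (scaledMollifier n m) (scaledMollifier n (m + 1)) (mollifierDiffPrimitive n m) j) y •
        v.1 (MultiIdx.single (n + 1) j) y‖ ≤
      B * (2 * A) ^ 2 * ‖v‖ * (2 ^ (3 / p.toReal - (n + 1 : ℕ))) ^ m := fun j => by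
    rw [norm_smul, norm_pow, norm_neg, norm_one, one_pow, one_mul]
    refine (T3.norm_integral_kernel_smul_le _ x (by positivity)
      (T3.forall_telescopeFactors (isBump_scaledMollifier n m) (isBump_scaledMollifier_succ n m)
        (isBump_mollifierDiffPrimitive n m) j)
      (T3.abs_kernel_telescopeFactors_le x hκ hκ' (hB m) j)).trans ?_
    rw [← two_pow_sq_mul_inv_mul_rpow]
    calc _ ≤ B * ((2 ^ m) ^ n)⁻¹ * (2 * A * 2 ^ m) ^ 2 *
          (((2 * (1 / 2 / 2 ^ m)) ^ 3) ^ (1 - 1 / p.toReal) * ‖v‖) := by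
            gcongr
            exact Sobolev.norm_apply_le v _
      _ = _ := by ring
  rw [Sobolev.mollify_succ_sub_mollify]
  refine (norm_sum_le_of_le _ fun j _ => hterm j).trans_eq ?_
  rw [Finset.sum_const, Finset.card_univ, Fintype.card_fin, nsmul_eq_mul]
  push_cast
  ring

theorem Sobolev.exists_norm_mollify_zero_le (n k : ℕ) :
    ∃ C, 0 ≤ C ∧ ∀ (v : Sobolev k p E) (x : T3), ‖mollify n 0 (Sobolev.fn v) x‖ ≤ C * ‖v‖ := by
  obtain ⟨A, hA⟩ := exists_abs_scaledMollifier_le n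
  have hA_nonneg : 0 ≤ A := by simpa using (abs_nonneg _).trans (hA 0 0)
  refine ⟨A ^ 3, by positivity, fun v x => ?_⟩
  have hkernel : ∀ y, |T3.kernel x (fun _ => scaledMollifier n 0) y| ≤ A ^ 3 := fun y => by
    simpa using T3.abs_kernel_le x (fun _ => hA 0) y
  refine (T3.norm_integral_kernel_smul_le _ x (by positivity)
    (fun _ => isBump_scaledMollifier n 0) hkernel).trans ?_
  gcongr
  simpa using Sobolev.norm_apply_le v (MultiIdx.zero k)

theorem integral_kernel_scaledMollifier (n m : ℕ) (x : T3) :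
    ∫ y, T3.kernel x (fun _ => scaledMollifier n m) y = 1 := by
  rw [T3.integral_kernel]
  exact Finset.prod_eq_one fun _ _ => integral_scaledMollifier n m

theorem exists_norm_mollify_sub_le (n : ℕ) [CompleteSpace E] :
    ∃ C, 0 ≤ C ∧ ∀ (w : C(T3, E)) (m : ℕ) (x : T3) (ε : ℝ),
      (∀ y ∈ Metric.closedBall x (1 / 2 / 2 ^ m), ‖w y - w x‖ ≤ ε) →
        ‖mollify n m w x - w x‖ ≤ C * ε := by
  obtain ⟨A, hA⟩ := exists_abs_scaledMollifier_le n
  have hA_nonneg : 0 ≤ A := by simpa using (abs_nonneg _).trans (hA 0 0)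
  refine ⟨A ^ 3, by positivity, fun w m x ε hε => ?_⟩
  have hε_nonneg : 0 ≤ ε :=
    (norm_nonneg _).trans (hε x (Metric.mem_closedBall_self (by positivity)))
  have hcont : Continuous (T3.kernel x fun _ => scaledMollifier n m) :=
    (T3.smooth_kernel x fun _ =>
      (isBump_scaledMollifier n m).mono (one_half_div_two_pow_le m)).continuous
  have h_int : ∀ g : T3 → E, Continuous g →
      Integrable (fun y => T3.kernel x (fun _ => scaledMollifier n m) y • g y) volume := fun g hg =>
    (hcont.smul hg).integrable_of_hasCompactSupport (.of_compactSpace _)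
  have hsub : mollify n m w x - w x =
      ∫ y, T3.kernel x (fun _ => scaledMollifier n m) y • (w y - w x) := by
    simp only [smul_sub]
    rw [integral_sub (h_int w w.continuous) (h_int _ continuous_const), integral_smul_const,
      integral_kernel_scaledMollifier, one_smul, mollify]
  rw [hsub, ← setIntegral_eq_integral_of_forall_compl_eq_zero
    (s := Metric.closedBall x (1 / 2 / 2 ^ m)) fun y hy => by
      rw [Function.notMem_support.mp
        (mt (T3.support_kernel_subset x (fun _ => isBump_scaledMollifier n m) ·) hy), zero_smul]]
  calc ‖∫ y in Metric.closedBall x (1 / 2 / 2 ^ m),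
          T3.kernel x (fun _ => scaledMollifier n m) y • (w y - w x)‖
      ≤ (A * 2 ^ m) ^ 3 * ε * volume.real (Metric.closedBall x (1 / 2 / 2 ^ m)) := by
        refine norm_setIntegral_le_of_norm_le_const (measure_lt_top _ _) fun y hy => ?_
        rw [norm_smul, Real.norm_eq_abs]
        gcongr
        · simpa using T3.abs_kernel_le x (fun _ => hA m) y
        · exact hε y hy
    _ ≤ (A * 2 ^ m) ^ 3 * ε * (2 * (1 / 2 / 2 ^ m)) ^ 3 := by
        gcongr
        exact ENNReal.toReal_le_of_le_ofReal (by positivity)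
          (T3.volume_closedBall_le x (by positivity))
    _ = A ^ 3 * ε := by field_simp

theorem tendsto_mollify [CompleteSpace E] (n : ℕ) (w : C(T3, E)) (x : T3) :
    Tendsto (fun m => mollify n m w x) atTop (𝓝 (w x)) := by
  obtain ⟨C, hC, hmollify⟩ := exists_norm_mollify_sub_le (E := E) n
  have hradius : Tendsto (fun m : ℕ => (1 : ℝ) / 2 / 2 ^ m) atTop (𝓝 0) :=
    tendsto_const_nhds.div_atTop (tendsto_pow_atTop_atTop_of_one_lt one_lt_two)
  rw [Metric.tendsto_nhds]
  intro ε hε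
  obtain ⟨δ, hδ, hw⟩ := Metric.continuous_iff.mp w.continuous x (ε / (C + 1)) (by positivity)
  filter_upwards [hradius.eventually_lt_const hδ] with m hm
  rw [dist_eq_norm]
  calc ‖mollify n m w x - w x‖ ≤ C * (ε / (C + 1)) :=
        hmollify w m x _ fun y hy => by
          rw [← dist_eq_norm]
          exact (hw y ((Metric.mem_closedBall.mp hy).trans_lt hm)).le
    _ = C / (C + 1) * ε := by ring
    _ < 1 * ε := by
        gcongr
        rw [div_lt_one (by positivity)]
        linarith
    _ = ε := one_mul ε

theorem Sobolev.exists_norm_le [CompleteSpace E] {k : ℕ} (hkp : 3 / p.toReal < k) :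
    ∃ C, 0 < C ∧ ∀ (v : Sobolev k p E) (w : C(T3, E)), Sobolev.fn v =ᵐ[volume] w →
      ∀ x, ‖w x‖ ≤ C * ‖v‖ := by
  obtain _ | n := k
  · exact absurd hkp (not_lt.mpr (by rw [Nat.cast_zero]; positivity))
  obtain ⟨A, hA_nonneg, hA⟩ := Sobolev.exists_norm_mollify_succ_sub_le (p := p) (E := E) n
  obtain ⟨B, hB_nonneg, hB⟩ := Sobolev.exists_norm_mollify_zero_le (p := p) (E := E) n (n + 1)
  set ρ : ℝ := 2 ^ (3 / p.toReal - (n + 1 : ℕ))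
  have hρ_nonneg : 0 ≤ ρ := by positivity
  have hρ_lt : ρ < 1 := Real.rpow_lt_one_of_one_lt_of_neg one_lt_two (by linarith)
  have hAρ_nonneg : 0 ≤ A * (1 - ρ)⁻¹ := mul_nonneg hA_nonneg (inv_nonneg.mpr (by linarith))
  refine ⟨B + A * (1 - ρ)⁻¹ + 1, by linarith, fun v w hvw x => ?_⟩
  have htelescope : ∀ m, ‖mollify n m (Sobolev.fn v) x‖ ≤
      B * ‖v‖ + A * ‖v‖ * ∑ i ∈ Finset.range m, ρ ^ i := by
    intro m
    induction m with
    | zero => simpa using hB v x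
    | succ m ih =>
      rw [Finset.sum_range_succ, mul_add]
      linarith [norm_le_norm_add_norm_sub' (mollify n (m + 1) (Sobolev.fn v) x)
        (mollify n m (Sobolev.fn v) x), hA v m x]
  have hbound : ∀ m, ‖mollify n m w x‖ ≤ (B + A * (1 - ρ)⁻¹ + 1) * ‖v‖ := fun m => by
    rw [← mollify_congr_ae n m hvw]
    calc _ ≤ B * ‖v‖ + A * ‖v‖ * (1 - ρ)⁻¹ := by
          refine (htelescope m).trans ?_
          gcongr
          rw [← tsum_geometric_of_lt_one hρ_nonneg hρ_lt]
          exact (summable_geometric_of_lt_one hρ_nonneg hρ_lt).sum_le_tsum _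
            fun i _ => by positivity
      _ ≤ _ := by linarith [norm_nonneg v]
  exact le_of_tendsto' (tendsto_mollify n w x).norm hbound

end Morrey

/-! ### Weak convergence -/

section WeakConvergence

variable {ι H K : Type*} {l : Filter ι} [NormedAddCommGroup H] [NormedSpace ℝ H]
  [NormedAddCommGroup K] [NormedSpace ℝ K]

/-- Convergence `b → a` along `l` in the weak topology of a normed space. -/
def TendstoWeakly (b : ι → H) (l : Filter ι) (a : H) : Prop :=
  Tendsto (fun i => toWeakSpace ℝ H (b i)) l (𝓝 (toWeakSpace ℝ H a))

theorem tendstoWeakly_iff_forall_dual {b : ι → H} {a : H} :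
    TendstoWeakly b l a ↔ ∀ f : StrongDual ℝ H, Tendsto (fun i => f (b i)) l (𝓝 (f a)) := by
  refine WeakBilin.tendsto_iff_forall_eval_tendsto _ fun x y hxy => ?_
  exact (SeparatingDual.eq_iff_forall_dual_eq (R := ℝ)).mpr fun f => DFunLike.congr_fun hxy f

namespace TendstoWeakly

variable {b : ι → H} {a : H}

theorem map (h : TendstoWeakly b l a) (T : H →L[ℝ] K) :
    TendstoWeakly (fun i => T (b i)) l (T a) :=
  ((WeakSpace.map T).continuous.tendsto _).comp h

theorem mem_of_frequently (h : TendstoWeakly b l a) {s : Set H} (hs : Convex ℝ s)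
    (hs_closed : IsClosed s) (hb : ∃ᶠ i in l, b i ∈ s) : a ∈ s := by
  have hweak : IsClosed (toWeakSpace ℝ H '' s) := by
    rw [← closure_eq_iff_isClosed, ← hs.toWeakSpace_closure ℝ, hs_closed.closure_eq]
  obtain ⟨x, hx, hxa⟩ := hweak.mem_of_frequently_of_tendsto
    (hb.mono fun i hi => Set.mem_image_of_mem _ hi) h
  rwa [← (toWeakSpace ℝ H).injective hxa]

end TendstoWeakly

theorem tendstoWeakly_of_tendsto {b : ι → H} {a : H} (h : Tendsto b l (𝓝 a)) :
    TendstoWeakly b l a :=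
  ((toWeakSpaceCLM ℝ H).continuous.tendsto a).comp h

end WeakConvergence

section Hilbert

variable {ι 𝕜 H : Type*} {l : Filter ι} [RCLike 𝕜] [NormedAddCommGroup H]

theorem tendsto_inner_of_dense_span [InnerProductSpace 𝕜 H] {b : ι → H} {a : H} {C : ℝ}
    (hC : ∀ᶠ i in l, ‖b i‖ ≤ C) {s : Set H} (hs : Dense (Submodule.span 𝕜 s : Set H))
    (h : ∀ d ∈ s, Tendsto (fun i => inner 𝕜 d (b i)) l (𝓝 (inner 𝕜 d a))) (g : H) :
    Tendsto (fun i => inner 𝕜 g (b i)) l (𝓝 (inner 𝕜 g a)) := by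
  have hspan : ∀ d ∈ Submodule.span 𝕜 s,
      Tendsto (fun i => inner 𝕜 d (b i)) l (𝓝 (inner 𝕜 d a)) := by
    intro d hd
    induction hd using Submodule.span_induction with
    | mem x hx => exact h x hx
    | zero => simpa only [inner_zero_left] using tendsto_const_nhds
    | add x y _ _ hx hy => simpa only [inner_add_left] using hx.add hy
    | smul c x _ hx => simpa only [inner_smul_left] using hx.const_mul _
  rw [Metric.tendsto_nhds]
  intro ε hε
  set R := max C 0 + ‖a‖ + 1
  have hR : 0 < R := by positivity
  obtain ⟨d, hd, hd_span⟩ := Metric.dense_iff.mp hs g (ε / (2 * R)) (by positivity)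
  rw [Metric.mem_ball, dist_comm, dist_eq_norm] at hd
  filter_upwards [hC, Metric.tendsto_nhds.mp (hspan d hd_span) (ε / 2) (by positivity)]
    with i hi hdi
  have hsub : ‖b i - a‖ ≤ R :=
    (norm_sub_le _ _).trans (by linarith [hi.trans (le_max_left C 0)])
  calc dist (inner 𝕜 g (b i)) (inner 𝕜 g a)
      = ‖inner 𝕜 (g - d) (b i - a) + (inner 𝕜 d (b i) - inner 𝕜 d a)‖ := by
        rw [dist_eq_norm]
        congr 1
        simp only [inner_sub_left, inner_sub_right]
        ring
    _ ≤ ε / (2 * R) * R + dist (inner 𝕜 d (b i)) (inner 𝕜 d a) := by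
        rw [dist_eq_norm]
        refine (norm_add_le _ _).trans (add_le_add_left ((norm_inner_le_norm _ _).trans ?_) _)
        gcongr
    _ < ε / 2 + ε / 2 := by
        have : ε / (2 * R) * R = ε / 2 := by field_simp
        linarith
    _ = ε := add_halves ε

theorem tendstoWeakly_of_dense_span [InnerProductSpace 𝕜 H] [NormedSpace ℝ H]
    [IsScalarTower ℝ 𝕜 H] [CompleteSpace H] {b : ι → H} {a : H} {C : ℝ}
    (hC : ∀ᶠ i in l, ‖b i‖ ≤ C) {s : Set H} (hs : Dense (Submodule.span 𝕜 s : Set H))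
    (h : ∀ d ∈ s, Tendsto (fun i => inner 𝕜 d (b i)) l (𝓝 (inner 𝕜 d a))) :
    TendstoWeakly b l a := by
  rw [tendstoWeakly_iff_forall_dual]
  intro f
  obtain ⟨g, hg⟩ := (InnerProductSpace.toDual 𝕜 H).surjective (StrongDual.extendRCLike f)
  have hf : ∀ x, f x = RCLike.re (inner 𝕜 g x) := fun x => by
    rw [← InnerProductSpace.toDual_apply_apply, hg, StrongDual.re_extendRCLike_apply]
  simp only [hf]
  exact (RCLike.continuous_re.tendsto _).comp (tendsto_inner_of_dense_span hC hs h g)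

end Hilbert

/-! ### Density of smooth test functions -/

section Density

theorem T3.Smooth.const (c : ℝ) : T3.Smooth fun _ => c := contDiff_const

theorem T3.Smooth.mul {φ ψ : T3 → ℝ} (hφ : T3.Smooth φ) (hψ : T3.Smooth ψ) :
    T3.Smooth fun x => φ x * ψ x := ContDiff.mul hφ hψ

theorem T3.Smooth.add {φ ψ : T3 → ℝ} (hφ : T3.Smooth φ) (hψ : T3.Smooth ψ) :
    T3.Smooth fun x => φ x + ψ x := ContDiff.add hφ hψ

/-- The algebra of smooth functions on the torus. -/
noncomputable def T3.smoothSubalgebra : Subalgebra ℝ C(T3, ℝ) where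
  carrier := {g | T3.Smooth g}
  mul_mem' hφ hψ := T3.Smooth.mul hφ hψ
  add_mem' hφ hψ := T3.Smooth.add hφ hψ
  algebraMap_mem' c := T3.Smooth.const c

theorem T3.mem_smoothSubalgebra {φ : C(T3, ℝ)} : φ ∈ T3.smoothSubalgebra ↔ T3.Smooth φ := Iff.rfl

theorem T3.contDiff_fourier_one_proj (j : Fin 3) :
    ContDiff ℝ ∞ fun y : Fin 3 → ℝ => (fourier 1 (T3.proj y j) : ℂ) := by
  simp only [T3.proj, fourier_coe_apply]
  exact Complex.contDiff_exp.comp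
    ((contDiff_const.mul (Complex.ofRealCLM.contDiff.comp (contDiff_apply ℝ ℝ j))).div_const _)

theorem T3.smooth_re_fourier (j : Fin 3) : T3.Smooth fun x => (fourier 1 (x j) : ℂ).re :=
  Complex.reCLM.contDiff.comp (T3.contDiff_fourier_one_proj j)

theorem T3.smooth_im_fourier (j : Fin 3) : T3.Smooth fun x => (fourier 1 (x j) : ℂ).im :=
  Complex.imCLM.contDiff.comp (T3.contDiff_fourier_one_proj j)

theorem T3.separatesPoints_smoothSubalgebra : T3.smoothSubalgebra.SeparatesPoints := by
  intro x y hxy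
  obtain ⟨j, hj⟩ := Function.ne_iff.mp hxy
  have hne : (fourier 1 (x j) : ℂ) ≠ fourier 1 (y j) := by
    rw [fourier_one, fourier_one]
    exact fun h => hj (AddCircle.injective_toCircle two_ne_zero (Subtype.ext h))
  by_cases hre : (fourier 1 (x j) : ℂ).re = (fourier 1 (y j) : ℂ).re
  · exact ⟨_, ⟨⟨_, (smooth_im_fourier j).continuous⟩,
      mem_smoothSubalgebra.mpr (smooth_im_fourier j), rfl⟩,
      fun him => hne (Complex.ext hre him)⟩
  · exact ⟨_, ⟨⟨_, (smooth_re_fourier j).continuous⟩,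
      mem_smoothSubalgebra.mpr (smooth_re_fourier j), rfl⟩, hre⟩

theorem T3.dense_smoothSubalgebra : Dense (T3.smoothSubalgebra : Set C(T3, ℝ)) := by
  rw [dense_iff_closure_eq, ← Subalgebra.topologicalClosure_coe,
    ContinuousMap.subalgebra_topologicalClosure_eq_top_of_separatesPoints _
      T3.separatesPoints_smoothSubalgebra, Algebra.coe_top]

theorem eq_zero_of_forall_integral_smooth_mul_eq_zero (h : Lp ℝ 2 (volume : Measure T3))
    (h0 : ∀ φ : T3 → ℝ, T3.Smooth φ → ∫ x, φ x * h x = 0) : h = 0 := by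
  have hdense : Dense (ContinuousMap.toLp (E := ℝ) 2 (volume : Measure T3) ℝ ''
      T3.smoothSubalgebra) :=
    (ContinuousMap.toLp_denseRange ℝ volume ℝ (by simp)).dense_image
      (ContinuousLinearMap.continuous _) T3.dense_smoothSubalgebra
  refine hdense.eq_zero_of_inner_left ℝ ?_
  rintro _ ⟨φ, hφ, rfl⟩
  rw [L2.inner_def, ← h0 φ (T3.mem_smoothSubalgebra.mp hφ)]
  refine integral_congr_ae ?_
  filter_upwards [ContinuousMap.coeFn_toLp (p := 2) (𝕜 := ℝ) (volume : Measure T3) φ] with x hx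
  rw [hx, RCLike.inner_apply, conj_trivial]

variable {E : Type*} [NormedAddCommGroup E] [InnerProductSpace ℝ E]

theorem memLp_smul_const {p : ℝ≥0∞} {φ : T3 → ℝ} (hφ : Continuous φ) (e : E) :
    MemLp (fun x => φ x • e) p (volume : Measure T3) :=
  (by fun_prop : Continuous fun x => φ x • e).memLp_of_hasCompactSupport (.of_compactSpace _)

/-- The test function `φ e ∈ L²(𝕋³; E)`. -/
noncomputable def testL2 {φ : T3 → ℝ} (hφ : Continuous φ) (e : E) :
    Lp E 2 (volume : Measure T3) := (memLp_smul_const hφ e).toLp _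

theorem inner_testL2 {φ : T3 → ℝ} (hφ : Continuous φ) (e : E) (h : Lp E 2 (volume : Measure T3)) :
    inner ℝ (testL2 hφ e) h = ∫ x, φ x * inner ℝ e (h x) := by
  rw [L2.inner_def]
  refine integral_congr_ae ?_
  filter_upwards [(memLp_smul_const hφ e).coeFn_toLp] with x hx
  rw [testL2, hx, real_inner_smul_left]

variable [CompleteSpace E]

theorem inner_testL2_eq_inner_integral {φ : T3 → ℝ} (hφ : Continuous φ) (e : E)
    (h : Lp E 2 (volume : Measure T3)) :
    inner ℝ (testL2 hφ e) h = inner ℝ e (∫ x, φ x • h x) := by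
  rw [inner_testL2, ← integral_inner (integrable_smul_Lp hφ h)]
  simp only [inner_smul_right]

theorem dense_span_testL2 [SecondCountableTopology E] :
    Dense (Submodule.span ℝ {g : Lp E 2 (volume : Measure T3) |
      ∃ (φ : T3 → ℝ) (hφ : T3.Smooth φ) (e : E), testL2 hφ.continuous e = g} :
      Set (Lp E 2 (volume : Measure T3))) := by
  rw [Submodule.dense_iff_topologicalClosure_eq_top, Submodule.topologicalClosure_eq_top_iff,
    Submodule.eq_bot_iff]
  intro h hh
  rw [Submodule.mem_orthogonal] at hh
  have hcoord : ∀ e : E, (fun x => inner ℝ e (h x)) =ᵐ[volume] 0 := by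
    intro e
    have hL := (innerSL ℝ e).coeFn_compLp h
    have hzero : (innerSL ℝ e).compLp h = 0 := by
      refine eq_zero_of_forall_integral_smooth_mul_eq_zero _ fun φ hφ => ?_
      rw [← hh _ (Submodule.subset_span ⟨φ, hφ, e, rfl⟩), inner_testL2]
      refine integral_congr_ae ?_
      filter_upwards [hL] with x hx
      rw [hx, innerSL_apply_apply]
    filter_upwards [hL, Lp.eq_zero_iff_ae_eq_zero.mp hzero] with x hx hx'
    rw [← innerSL_apply_apply ℝ e (h x), ← hx, hx']
  exact Lp.eq_zero_iff_ae_eq_zero.mpr (ae_eq_zero_of_forall_inner (𝕜 := ℝ) hcoord)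

end Density

/-! ### Lower semicontinuity and uniform convexity of `L^p` norms -/

section Inclusion

variable {Ω : Type*} [MeasurableSpace Ω] {μ : Measure Ω} {E : Type*} [NormedAddCommGroup E]
  {r p : ℝ≥0∞}

theorem isClosed_setOf_eLpNorm_le [Fact (1 ≤ r)] (C : ℝ≥0∞) :
    IsClosed {g : Lp E r μ | eLpNorm g p μ ≤ C} :=
  IsSeqClosed.isClosed fun _ _ hg hlim =>
    eLpNorm_le_of_tendstoInMeasure (Eventually.of_forall hg)
      (tendstoInMeasure_of_tendsto_Lp hlim) fun _ => (Lp.memLp _).1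

theorem convex_setOf_eLpNorm_le [NormedSpace ℝ E] [Fact (1 ≤ p)] (C : ℝ≥0∞) :
    Convex ℝ {g : Lp E r μ | eLpNorm g p μ ≤ C} := by
  intro g hg g' hg' a b ha hb hab
  have hcoe : ((a • g + b • g' : Lp E r μ) : Ω → E) =ᵐ[μ] a • (g : Ω → E) + b • (g' : Ω → E) :=
    (Lp.coeFn_add _ _).trans ((Lp.coeFn_smul a g).add (Lp.coeFn_smul b g'))
  rw [Set.mem_ofPred_eq] at hg hg' ⊢
  calc eLpNorm (a • g + b • g' : Lp E r μ) p μ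
      = eLpNorm (a • (g : Ω → E) + b • (g' : Ω → E)) p μ := eLpNorm_congr_ae hcoe
    _ ≤ eLpNorm (a • (g : Ω → E)) p μ + eLpNorm (b • (g' : Ω → E)) p μ :=
        eLpNorm_add_le ((Lp.memLp g).1.const_smul a) ((Lp.memLp g').1.const_smul b) Fact.out
    _ = ENNReal.ofReal a * eLpNorm g p μ + ENNReal.ofReal b * eLpNorm g' p μ := by
        rw [eLpNorm_const_smul, eLpNorm_const_smul, Real.enorm_of_nonneg ha,
          Real.enorm_of_nonneg hb]
    _ ≤ ENNReal.ofReal a * C + ENNReal.ofReal b * C := by gcongr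
    _ = C := by rw [← add_mul, ← ENNReal.ofReal_add ha hb, hab, ENNReal.ofReal_one, one_mul]

variable [Fact (1 ≤ r)] [Fact (1 ≤ p)] [IsFiniteMeasure μ]

theorem norm_toLp_mono_exponent_le (hrp : r ≤ p) (v : Lp E p μ) :
    ‖((Lp.memLp v).mono_exponent hrp).toLp v‖ ≤
      (μ Set.univ ^ (1 / r.toReal - 1 / p.toReal)).toReal * ‖v‖ := by
  have hexp : 0 ≤ 1 / r.toReal - 1 / p.toReal := by
    rcases eq_or_ne p ⊤ with rfl | hp
    · simp
    · have hr : 1 ≤ r.toReal := by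
        simpa using ENNReal.toReal_mono (ne_top_of_le_ne_top hp hrp) (Fact.out : 1 ≤ r)
      exact sub_nonneg.mpr (one_div_le_one_div_of_le (zero_lt_one.trans_le hr)
        (ENNReal.toReal_mono hp hrp))
  rw [Lp.norm_toLp, Lp.norm_def, mul_comm, ← ENNReal.toReal_mul]
  exact ENNReal.toReal_mono (ENNReal.mul_ne_top (Lp.memLp v).2.ne
    (ENNReal.rpow_ne_top_of_nonneg hexp (measure_ne_top _ _)))
    (eLpNorm_le_eLpNorm_mul_rpow_measure_univ hrp (Lp.memLp v).1)

variable [NormedSpace ℝ E]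

/-- The inclusion `L^p ⊆ L^r`, `r ≤ p`, for a finite measure. -/
noncomputable def lpInclusion (hrp : r ≤ p) : Lp E p μ →L[ℝ] Lp E r μ :=
  LinearMap.mkContinuous
    { toFun := fun v => ((Lp.memLp v).mono_exponent hrp).toLp v
      map_add' := fun v w => by
        rw [← MemLp.toLp_add]
        exact MemLp.toLp_congr _ _ (Lp.coeFn_add v w)
      map_smul' := fun c v => by
        rw [RingHom.id_apply, ← MemLp.toLp_const_smul]
        exact MemLp.toLp_congr _ _ (Lp.coeFn_smul c v) }
    _ (norm_toLp_mono_exponent_le hrp)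

theorem coeFn_lpInclusion (hrp : r ≤ p) (v : Lp E p μ) : lpInclusion hrp v =ᵐ[μ] v :=
  MemLp.coeFn_toLp ((Lp.memLp v).mono_exponent hrp)

theorem lpInclusion_injective (hrp : r ≤ p) :
    Function.Injective (lpInclusion hrp : Lp E p μ → Lp E r μ) := fun v w h =>
  Lp.ext ((coeFn_lpInclusion hrp v).symm.trans (h ▸ coeFn_lpInclusion hrp w))

theorem TendstoWeakly.eventually_lt_norm_of_lpInclusion {ι : Type*} {l : Filter ι} (hrp : r ≤ p)
    {b : ι → Lp E p μ} {a : Lp E p μ}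
    (h : TendstoWeakly (fun i => lpInclusion hrp (b i)) l (lpInclusion hrp a))
    {c : ℝ} (hc : c < ‖a‖) : ∀ᶠ i in l, c < ‖b i‖ := by
  by_contra hfreq
  rw [not_eventually] at hfreq
  have hnorm : ∀ v : Lp E p μ, eLpNorm (lpInclusion hrp v) p μ = ENNReal.ofReal ‖v‖ := fun v => by
    rw [eLpNorm_congr_ae (coeFn_lpInclusion hrp v), Lp.norm_def,
      ENNReal.ofReal_toReal (Lp.memLp v).2.ne]
  have hmem := h.mem_of_frequently (convex_setOf_eLpNorm_le (p := p) (ENNReal.ofReal c))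
    (isClosed_setOf_eLpNorm_le _) (hfreq.mono fun i hi => by
      rw [Set.mem_ofPred_eq, hnorm]
      exact ENNReal.ofReal_le_ofReal (not_lt.mp hi))
  rw [Set.mem_ofPred_eq, hnorm] at hmem
  obtain ⟨i, hi⟩ := hfreq.exists
  exact hc.not_ge <|
    (ENNReal.ofReal_le_ofReal_iff ((norm_nonneg _).trans (not_lt.mp hi))).mp hmem

end Inclusion

theorem tendsto_min_of_forall_eventually_lt {ι : Type*} {l : Filter ι} {x : ι → ℝ} {a : ℝ}
    (h : ∀ c < a, ∀ᶠ i in l, c < x i) : Tendsto (fun i => min (x i) a) l (𝓝 a) := by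
  rw [tendsto_order]
  refine ⟨fun c hc => ?_, fun c hc => Eventually.of_forall fun i => (min_le_right _ _).trans_lt hc⟩
  filter_upwards [h c hc] with i hi using lt_min hi hc

/-- Clarkson's inequality with exponent `P ≥ 2`, which makes a normed space uniformly convex. -/
def ClarksonInequality (P : ℝ) (H : Type*) [NormedAddCommGroup H] [NormedSpace ℝ H] : Prop :=
  ∀ a b : H, ‖(2⁻¹ : ℝ) • (a + b)‖ ^ P + ‖(2⁻¹ : ℝ) • (a - b)‖ ^ P ≤ 2⁻¹ * (‖a‖ ^ P + ‖b‖ ^ P)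

section Clarkson

theorem clarksonInequality_inner {E : Type*} [NormedAddCommGroup E] [InnerProductSpace ℝ E] {P : ℝ}
    (hP : 2 ≤ P) : ClarksonInequality P E := by
  intro a b
  have hsq : ∀ x : E, ‖x‖ ^ P = (‖x‖ ^ 2) ^ (P / 2) := fun x => by
    rw [← Real.rpow_natCast_mul (norm_nonneg x), Nat.cast_ofNat, mul_div_cancel₀ P two_ne_zero]
  have hparallelogram : ‖(2⁻¹ : ℝ) • (a + b)‖ ^ 2 + ‖(2⁻¹ : ℝ) • (a - b)‖ ^ 2 =
      2⁻¹ * ‖a‖ ^ 2 + 2⁻¹ * ‖b‖ ^ 2 := by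
    rw [norm_smul, norm_smul, mul_pow, mul_pow, norm_inv, Real.norm_two]
    linarith [parallelogram_law_with_norm ℝ a b]
  have hP2 : 1 ≤ P / 2 := by linarith
  rw [hsq, hsq, hsq a, hsq b]
  calc (‖(2⁻¹ : ℝ) • (a + b)‖ ^ 2) ^ (P / 2) + (‖(2⁻¹ : ℝ) • (a - b)‖ ^ 2) ^ (P / 2)
      ≤ (‖(2⁻¹ : ℝ) • (a + b)‖ ^ 2 + ‖(2⁻¹ : ℝ) • (a - b)‖ ^ 2) ^ (P / 2) :=
        Real.add_rpow_le_rpow_add (sq_nonneg _) (sq_nonneg _) hP2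
    _ = (2⁻¹ * ‖a‖ ^ 2 + 2⁻¹ * ‖b‖ ^ 2) ^ (P / 2) := by rw [hparallelogram]
    _ ≤ 2⁻¹ * (‖a‖ ^ 2) ^ (P / 2) + 2⁻¹ * (‖b‖ ^ 2) ^ (P / 2) :=
        (convexOn_rpow hP2).2 (sq_nonneg ‖a‖) (sq_nonneg ‖b‖) (by norm_num) (by norm_num)
          (by norm_num)
    _ = _ := by ring

theorem two_le_toReal {p : ℝ≥0∞} (hp : 2 ≤ p) (hp_top : p ≠ ⊤) : 2 ≤ p.toReal := by
  simpa using ENNReal.toReal_mono hp_top hp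

section Lp

variable {Ω : Type*} [MeasurableSpace Ω] {μ : Measure Ω} {E : Type*} [NormedAddCommGroup E]
  {p : ℝ≥0∞}

theorem Lp_norm_rpow_toReal_eq_integral (hp : p ≠ 0) (hp_top : p ≠ ⊤) (v : Lp E p μ) :
    ‖v‖ ^ p.toReal = ∫ x, ‖v x‖ ^ p.toReal ∂μ := by
  have hi : 0 ≤ ∫ x, ‖v x‖ ^ p.toReal ∂μ := integral_nonneg fun _ => by positivity
  rw [Lp.norm_def, (Lp.memLp v).eLpNorm_eq_integral_rpow_norm hp hp_top,
    ENNReal.toReal_ofReal (by positivity), Real.rpow_inv_rpow hi (ENNReal.toReal_pos hp hp_top).ne']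

theorem ClarksonInequality.lp [NormedSpace ℝ E] [Fact (1 ≤ p)] (hp_top : p ≠ ⊤)
    (h : ClarksonInequality p.toReal E) : ClarksonInequality p.toReal (Lp E p μ) := by
  intro a b
  have h0 : p ≠ 0 := (zero_lt_one.trans_le Fact.out).ne'
  have h_int : ∀ v : Lp E p μ, Integrable (fun x => ‖v x‖ ^ p.toReal) μ :=
    fun v => (Lp.memLp v).integrable_norm_rpow h0 hp_top
  simp only [Lp_norm_rpow_toReal_eq_integral h0 hp_top]
  rw [← integral_add (h_int _) (h_int _), ← integral_add (h_int _) (h_int _), ← integral_const_mul]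
  refine integral_mono_ae ((h_int _).add (h_int _)) (((h_int _).add (h_int _)).const_mul _) ?_
  filter_upwards [Lp.coeFn_smul (2⁻¹ : ℝ) (a + b), Lp.coeFn_smul (2⁻¹ : ℝ) (a - b),
    Lp.coeFn_add a b, Lp.coeFn_sub a b] with x hsmul_add hsmul_sub hadd hsub
  rw [hsmul_add, hsmul_sub, Pi.smul_apply, Pi.smul_apply, hadd, hsub]
  exact h (a x) (b x)

end Lp

theorem PiLp_norm_rpow_toReal {ι : Type*} [Fintype ι] {β : ι → Type*}
    [∀ i, NormedAddCommGroup (β i)] {p : ℝ≥0∞} (hp : 0 < p.toReal) (v : PiLp p β) :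
    ‖v‖ ^ p.toReal = ∑ i, ‖v i‖ ^ p.toReal := by
  rw [PiLp.norm_eq_sum hp, ← Real.rpow_mul (by positivity), one_div_mul_cancel hp.ne',
    Real.rpow_one]

theorem ClarksonInequality.piLp {ι : Type*} [Fintype ι] {β : ι → Type*}
    [∀ i, NormedAddCommGroup (β i)] [∀ i, NormedSpace ℝ (β i)] {p : ℝ≥0∞} [Fact (1 ≤ p)]
    (hp : 0 < p.toReal) (h : ∀ i, ClarksonInequality p.toReal (β i)) :
    ClarksonInequality p.toReal (PiLp p β) := by
  intro a b
  simp only [PiLp_norm_rpow_toReal hp]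
  rw [← Finset.sum_add_distrib, ← Finset.sum_add_distrib, Finset.mul_sum]
  exact Finset.sum_le_sum fun i _ => h i (a i) (b i)

theorem ClarksonInequality.tendsto {ι H : Type*} {l : Filter ι} [NormedAddCommGroup H]
    [NormedSpace ℝ H] {P : ℝ} (h : ClarksonInequality P H) (hP : 0 < P) {b : ι → H} {a : H}
    (hnorm : Tendsto (fun i => ‖b i‖) l (𝓝 ‖a‖))
    (hlsc : ∀ c < ‖a‖, ∀ᶠ i in l, c < ‖(2⁻¹ : ℝ) • (a + b i)‖) : Tendsto b l (𝓝 a) := by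
  have hlim : Tendsto (fun i => 2⁻¹ * (‖a‖ ^ P + ‖b i‖ ^ P) -
      (min ‖(2⁻¹ : ℝ) • (a + b i)‖ ‖a‖) ^ P) l (𝓝 0) := by
    have := (((hnorm.rpow_const (Or.inr hP.le)).const_add (‖a‖ ^ P)).const_mul 2⁻¹).sub
      ((tendsto_min_of_forall_eventually_lt hlsc).rpow_const (Or.inr hP.le))
    rwa [← two_mul, inv_mul_cancel_left₀ two_ne_zero, sub_self] at this
  have hpow : Tendsto (fun i => ‖(2⁻¹ : ℝ) • (a - b i)‖ ^ P) l (𝓝 0) := by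
    refine squeeze_zero (fun i => by positivity) (fun i => ?_) hlim
    have hmin : (min ‖(2⁻¹ : ℝ) • (a + b i)‖ ‖a‖) ^ P ≤ ‖(2⁻¹ : ℝ) • (a + b i)‖ ^ P := by
      gcongr
      exact min_le_left _ _
    linarith [h a (b i)]
  have hroot := (hpow.rpow_const (p := P⁻¹) (Or.inr (by positivity))).const_mul 2
  rw [Real.zero_rpow (inv_ne_zero hP.ne'), mul_zero] at hroot
  refine tendsto_iff_norm_sub_tendsto_zero.mpr (hroot.congr fun i => ?_)
  rw [Real.rpow_rpow_inv (norm_nonneg _) hP.ne', norm_smul, norm_sub_rev, norm_inv, Real.norm_two,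
    mul_inv_cancel_left₀ two_ne_zero]

end Clarkson

/-! ### Sobolev spaces on the torus -/

namespace Sobolev

section Weak

variable {E : Type*} [NormedAddCommGroup E] [InnerProductSpace ℝ E] {p : ℝ≥0∞} [Fact (1 ≤ p)]
  {k : ℕ}

theorem clarksonInequality (hp : 2 ≤ p) (hp_top : p ≠ ⊤) :
    ClarksonInequality p.toReal (Sobolev k p E) := fun a b =>
  ClarksonInequality.piLp (zero_lt_two.trans_le (two_le_toReal hp hp_top))
    (fun _ => (clarksonInequality_inner (two_le_toReal hp hp_top)).lp hp_top) a.1 b.1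

/-- The `L²` class of a Sobolev function with exponent `p ≥ 2`. -/
noncomputable def toL2 (hp : 2 ≤ p) : Sobolev k p E →L[ℝ] Lp E 2 (volume : Measure T3) :=
  (lpInclusion hp).comp ((PiLp.proj p (fun _ : MultiIdx k => Lp E p (volume : Measure T3))
    (MultiIdx.zero k)).comp (Sobolev k p E).subtypeL)

theorem toL2_apply (hp : 2 ≤ p) (v : Sobolev k p E) :
    toL2 hp v = lpInclusion hp (v.1 (MultiIdx.zero k)) := rfl

theorem coeFn_toL2 (hp : 2 ≤ p) (v : Sobolev k p E) : toL2 hp v =ᵐ[volume] fn v :=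
  coeFn_lpInclusion hp _

variable [CompleteSpace E]

theorem inner_testL2_lpInclusion (hp : 2 ≤ p) (v : Sobolev k p E) (α : MultiIdx k) {φ : T3 → ℝ}
    (hφ : T3.Smooth φ) (e : E) :
    inner ℝ (testL2 hφ.continuous e) (lpInclusion hp (v.1 α)) = (-1) ^ (∑ j, (α.1 j : ℕ)) *
      inner ℝ (testL2 (hφ.multiDeriv fun j => (α.1 j : ℕ)).continuous e) (toL2 hp v) := by
  have hintegral : ∀ (ψ : T3 → ℝ) (w : Lp E p (volume : Measure T3)),
      ∫ x, ψ x • lpInclusion hp w x = ∫ x, ψ x • w x := fun ψ w => integral_congr_ae (by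
    filter_upwards [coeFn_lpInclusion (r := 2) hp w] with x hx
    rw [hx])
  rw [inner_testL2_eq_inner_integral, inner_testL2_eq_inner_integral, toL2_apply, hintegral,
    hintegral, v.2 α φ hφ, inner_smul_right, ← mul_assoc, ← mul_pow, neg_mul_neg, one_mul, one_pow,
    one_mul]

variable [SecondCountableTopology E] {ι : Type*} {l : Filter ι}

theorem tendstoWeakly_lpInclusion (hp : 2 ≤ p) {b : ι → Sobolev k p E} {a : Sobolev k p E} {C : ℝ}
    (hC : ∀ᶠ i in l, ‖b i‖ ≤ C)
    (h : TendstoWeakly (fun i => toL2 hp (b i)) l (toL2 hp a)) (α : MultiIdx k) :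
    TendstoWeakly (fun i => lpInclusion hp ((b i).1 α)) l
      (lpInclusion hp (a.1 α) : Lp E 2 (volume : Measure T3)) := by
  refine tendstoWeakly_of_dense_span
    (C := ‖(lpInclusion hp : Lp E p (volume : Measure T3) →L[ℝ] Lp E 2 volume)‖ * C)
    ?_ dense_span_testL2 ?_
  · filter_upwards [hC] with i hi
    refine (ContinuousLinearMap.le_opNorm _ _).trans ?_
    gcongr
    exact (norm_apply_le _ α).trans hi
  · rintro _ ⟨φ, hφ, e, rfl⟩
    simp only [inner_testL2_lpInclusion hp _ α hφ e]
    exact (tendstoWeakly_iff_forall_dual.mp h (innerSL ℝ _)).const_mul _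

theorem eventually_lt_norm (hp : 2 ≤ p) (hp_top : p ≠ ⊤) {b : ι → Sobolev k p E}
    {a : Sobolev k p E} {C : ℝ} (hC : ∀ᶠ i in l, ‖b i‖ ≤ C)
    (h : TendstoWeakly (fun i => toL2 hp (b i)) l (toL2 hp a)) {c : ℝ} (hc : c < ‖a‖) :
    ∀ᶠ i in l, c < ‖b i‖ := by
  have hP : 0 < p.toReal := zero_lt_two.trans_le (two_le_toReal hp hp_top)
  have hderiv : ∀ α, Tendsto (fun i => min ‖(b i).1 α‖ ‖a.1 α‖) l (𝓝 ‖a.1 α‖) := fun α =>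
    tendsto_min_of_forall_eventually_lt fun r hr =>
      (tendstoWeakly_lpInclusion hp hC h α).eventually_lt_norm_of_lpInclusion hp hr
  have hsum : Tendsto (fun i => (∑ α, (min ‖(b i).1 α‖ ‖a.1 α‖) ^ p.toReal) ^ (1 / p.toReal)) l
      (𝓝 ((∑ α, ‖a.1 α‖ ^ p.toReal) ^ (1 / p.toReal))) :=
    (tendsto_finsetSum _ fun α _ => (hderiv α).rpow_const (Or.inr hP.le)).rpow_const
      (Or.inr (by positivity))
  rw [← PiLp.norm_eq_sum hP] at hsum
  filter_upwards [hsum.eventually (lt_mem_nhds hc)] with i hi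
  refine hi.trans_le ?_
  rw [Submodule.coe_norm, PiLp.norm_eq_sum hP]
  gcongr with α
  exact min_le_left _ _

theorem tendsto_of_tendstoWeakly_of_tendsto_norm (hp : 2 ≤ p) (hp_top : p ≠ ⊤)
    {b : ι → Sobolev k p E} {a : Sobolev k p E} (hnorm : Tendsto (fun i => ‖b i‖) l (𝓝 ‖a‖))
    (h : TendstoWeakly (fun i => toL2 hp (b i)) l (toL2 hp a)) : Tendsto b l (𝓝 a) := by
  have hweak : TendstoWeakly (fun i => toL2 hp ((2⁻¹ : ℝ) • (a + b i))) l (toL2 hp a) := by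
    have hmid : (2⁻¹ : ℝ) • (toL2 hp a + toL2 hp a) = toL2 hp a := by
      rw [← two_smul ℝ, inv_smul_smul₀ two_ne_zero]
    rw [tendstoWeakly_iff_forall_dual] at h ⊢
    intro f
    rw [← hmid]
    simpa only [map_smul, map_add] using ((h f).const_add (f (toL2 hp a))).const_smul (2⁻¹ : ℝ)
  have hbound : ∀ᶠ i in l, ‖(2⁻¹ : ℝ) • (a + b i)‖ ≤ ‖a‖ + 1 := by
    filter_upwards [hnorm.eventually (gt_mem_nhds (lt_add_one ‖a‖))] with i hi
    rw [norm_smul, norm_inv, Real.norm_two]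
    linarith [norm_nonneg a, norm_add_le a (b i)]
  exact (clarksonInequality hp hp_top).tendsto
    (zero_lt_two.trans_le (two_le_toReal hp hp_top)) hnorm
    fun c hc => eventually_lt_norm hp hp_top hbound hweak hc

theorem toL2_injective (hp : 2 ≤ p) :
    Function.Injective (toL2 hp : Sobolev k p E → Lp E 2 (volume : Measure T3)) := by
  intro v w h
  have hconst : TendstoWeakly (fun _ : Unit => toL2 hp w) ⊤ (toL2 hp v) :=
    h ▸ tendsto_const_nhds
  refine Subtype.ext (PiLp.ext fun α => lpInclusion_injective hp ?_)
  exact (tendstoWeakly_lpInclusion hp (C := ‖w‖) (by simp) hconst α).mem_of_frequently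
    (convex_singleton _) isClosed_singleton (Frequently.of_forall fun _ => rfl)

end Weak

section Completeness

variable {E : Type*} [NormedAddCommGroup E] [NormedSpace ℝ E] {p : ℝ≥0∞} [Fact (1 ≤ p)] {k : ℕ}

theorem continuous_integral_smul_Lp {φ : T3 → ℝ} (hφ : Continuous φ) :
    Continuous fun v : Lp E p (volume : Measure T3) => ∫ x, φ x • v x := by
  obtain ⟨C, hC⟩ := isCompact_univ.exists_bound_of_continuousOn (f := φ) hφ.continuousOn
  have hC_nonneg : 0 ≤ C := (norm_nonneg _).trans (hC 0 trivial)
  have h_int : ∀ v : Lp E p (volume : Measure T3), Integrable v volume := fun v =>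
    (Lp.memLp v).integrable Fact.out
  refine (LipschitzWith.of_dist_le_mul (K := (C * (volume : Measure T3).real Set.univ ^
    (1 - 1 / p.toReal)).toNNReal) fun v w => ?_).continuous
  rw [dist_eq_norm, dist_eq_norm, Real.coe_toNNReal _ (by positivity),
    ← integral_sub (integrable_smul_Lp hφ v) (integrable_smul_Lp hφ w)]
  calc ‖∫ x, (φ x • v x - φ x • w x)‖ ≤ ∫ x, C * ‖(v - w) x‖ := by
        refine norm_integral_le_of_norm_le ((h_int _).norm.const_mul _) ?_
        filter_upwards [Lp.coeFn_sub v w] with x hx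
        rw [hx, ← smul_sub, norm_smul, Pi.sub_apply]
        gcongr
        exact hC x trivial
    _ = C * ∫ x, ‖(v - w) x‖ := integral_const_mul _ _
    _ ≤ C * ((volume : Measure T3).real Set.univ ^ (1 - 1 / p.toReal) * ‖v - w‖) := by
        gcongr
        simpa only [setIntegral_univ] using
          setIntegral_norm_le_measureReal_rpow_mul_norm (v - w) (measure_ne_top _ Set.univ)
    _ = _ := by ring

theorem isClosed : IsClosed (Sobolev k p E : Set (PiLp p
    (fun _ : MultiIdx k => Lp E p (volume : Measure T3)))) := by
  have hInter : (Sobolev k p E : Set (PiLp p (fun _ : MultiIdx k => Lp E p volume))) =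
      ⋂ (α : MultiIdx k) (φ : T3 → ℝ) (_ : T3.Smooth φ),
        {V | ∫ x, T3.multiDeriv (fun j => (α.1 j : ℕ)) φ x • V (MultiIdx.zero k) x =
          (-1 : ℝ) ^ (∑ j, (α.1 j : ℕ)) • ∫ x, φ x • V α x} := by
    ext V
    simp only [Set.mem_iInter, Set.mem_ofPred_eq]
    rfl
  rw [hInter]
  refine isClosed_iInter fun α => isClosed_iInter fun φ => isClosed_iInter fun hφ =>
    isClosed_eq ?_ ?_
  · exact (continuous_integral_smul_Lp (hφ.multiDeriv _).continuous).comp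
      (PiLp.continuous_apply p _ _)
  · exact ((continuous_integral_smul_Lp hφ.continuous).comp
      (PiLp.continuous_apply p _ _)).const_smul _

instance completeSpace [CompleteSpace E] : CompleteSpace (Sobolev k p E) :=
  isClosed.completeSpace_coe

theorem secondCountableTopology [SecondCountableTopology E] (hp : p ≠ ⊤) :
    SecondCountableTopology (Sobolev k p E) := by
  have : Fact (p ≠ ⊤) := ⟨hp⟩
  have : SecondCountableTopology (Lp E p (volume : Measure T3)) := inferInstance
  have : SecondCountableTopology (PiLp p (fun _ : MultiIdx k => Lp E p (volume : Measure T3))) :=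
    inferInstance
  exact TopologicalSpace.Subtype.secondCountableTopology _

end Completeness

end Sobolev

/-! ### The norm of the reciprocal -/

section InvCNorm

variable {f : T3 → ℝ} {w : C(T3, ℝ)}

theorem invCNorm_eq_of_ae (h : f =ᵐ[volume] w) : invCNorm f = ⨆ x, ‖w x‖ₑ⁻¹ := by
  refine le_antisymm (iInf₂_le w h) (le_iInf₂ fun w' h' => ?_)
  rw [(w.continuous.ae_eq_iff_eq volume w'.continuous).mp (h.symm.trans h')]

theorem exists_ae_eq_of_invCNorm_lt_top (h : invCNorm f < ⊤) : ∃ w : C(T3, ℝ), f =ᵐ[volume] w := by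
  by_contra! hw
  exact h.ne (iInf₂_eq_top.mpr fun w hfw => absurd hfw (hw w))

theorem invCNorm_le_ofReal_iff_of_ae (h : f =ᵐ[volume] w) {r : ℝ} (hr : 0 < r) :
    invCNorm f ≤ ENNReal.ofReal r ↔ ∀ x, r⁻¹ ≤ |w x| := by
  rw [invCNorm_eq_of_ae h, iSup_le_iff]
  refine forall_congr' fun x => ?_
  rw [ENNReal.inv_le_iff_inv_le, ← ENNReal.ofReal_inv_of_pos hr, Real.enorm_eq_ofReal_abs,
    ENNReal.ofReal_le_ofReal_iff (abs_nonneg _)]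

theorem invCNorm_pos (f : T3 → ℝ) : 0 < invCNorm f := by
  rcases eq_or_ne (invCNorm f) ⊤ with h | h
  · rw [h]; exact ENNReal.zero_lt_top
  · obtain ⟨w, hw⟩ := exists_ae_eq_of_invCNorm_lt_top h.lt_top
    rw [invCNorm_eq_of_ae hw]
    exact (ENNReal.inv_pos.mpr enorm_ne_top).trans_le (le_iSup (fun x => ‖w x‖ₑ⁻¹) (0 : T3))

theorem invCNorm_eq_top_of_ae_eq_zero (h : f =ᵐ[volume] 0) : invCNorm f = ⊤ := by
  rw [invCNorm_eq_of_ae (w := (0 : C(T3, ℝ))) h]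
  simp

end InvCNorm

section Order

theorem Lp_le_iff_forall_le_of_ae {X : Type*} [TopologicalSpace X] [MeasurableSpace X]
    {μ : Measure X} [μ.IsOpenPosMeasure] {p : ℝ≥0∞} {f g : Lp ℝ p μ} {v w : X → ℝ}
    (hf : f =ᵐ[μ] v) (hg : g =ᵐ[μ] w) (hv : Continuous v) (hw : Continuous w) :
    f ≤ g ↔ ∀ x, v x ≤ w x := by
  have hae : f ≤ g ↔ ∀ᵐ x ∂μ, v x ≤ w x := by
    rw [← Lp.coeFn_le]
    exact eventually_congr (by filter_upwards [hf, hg] with x hfx hgx; rw [hfx, hgx])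
  refine hae.trans ⟨fun h x => ?_, Eventually.of_forall⟩
  exact (isClosed_le hv hw).closure_subset (Measure.dense_of_ae h x)

theorem posSMulMono_Lp {Ω : Type*} [MeasurableSpace Ω] {μ : Measure Ω} {p : ℝ≥0∞} :
    PosSMulMono ℝ (Lp ℝ p μ) :=
  PosSMulMono.of_smul_nonneg fun c hc f hf => by
    rw [← Lp.coeFn_nonneg] at hf ⊢
    filter_upwards [hf, Lp.coeFn_smul c f] with x hx hsmul
    rw [hsmul]
    exact mul_nonneg hc hx

theorem forall_le_or_forall_le_neg {X : Type*} [TopologicalSpace X] [PreconnectedSpace X]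
    {w : X → ℝ} (hw : Continuous w) {c : ℝ} (hc : 0 < c) (h : ∀ x, c ≤ |w x|) :
    (∀ x, c ≤ w x) ∨ ∀ x, w x ≤ -c := by
  by_contra! hcon
  obtain ⟨⟨x, hx⟩, y, hy⟩ := hcon
  have hx' : w x ≤ 0 := by rcases le_abs.mp (h x) with h1 | h1 <;> linarith
  have hy' : 0 ≤ w y := by rcases le_abs.mp (h y) with h1 | h1 <;> linarith
  obtain ⟨t, ht⟩ := mem_range_of_exists_le_of_exists_ge hw ⟨x, hx'⟩ ⟨y, hy'⟩
  have hct := h t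
  rw [ht, abs_zero] at hct
  exact hc.not_ge hct

end Order

section InvCNorm

variable {p : ℝ≥0∞}

theorem invCNorm_congr_ae {f g : T3 → ℝ} (h : f =ᵐ[volume] g) : invCNorm f = invCNorm g :=
  iInf_congr fun _ => iInf_congr_Prop ⟨h.symm.trans, h.trans⟩ fun _ => rfl

theorem invCNorm_le_ofReal_iff_const_le_or_le_const {g : Lp ℝ p (volume : Measure T3)}
    {w : C(T3, ℝ)} (hg : g =ᵐ[volume] w) {r : ℝ} (hr : 0 < r) :
    invCNorm g ≤ ENNReal.ofReal r ↔
      Lp.const p volume r⁻¹ ≤ g ∨ g ≤ Lp.const p volume (-r⁻¹) := by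
  rw [invCNorm_le_ofReal_iff_of_ae hg hr,
    Lp_le_iff_forall_le_of_ae (Lp.coeFn_const p volume _) hg continuous_const w.continuous,
    Lp_le_iff_forall_le_of_ae hg (Lp.coeFn_const p volume _) w.continuous continuous_const]
  constructor
  · exact forall_le_or_forall_le_neg w.continuous (inv_pos.mpr hr)
  · rintro (h | h) x
    · exact (h x).trans (le_abs_self _)
    · exact (le_neg_of_le_neg (h x)).trans (neg_le_abs _)

-- A continuous function bounded away from zero on the connected torus has a constant sign, so the
-- condition `invCNorm g ≤ r` cuts out two closed convex sets.
theorem TendstoWeakly.eventually_lt_invCNorm [Fact (1 ≤ p)] {ι : Type*} {l : Filter ι}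
    {b : ι → Lp ℝ p (volume : Measure T3)} {a : Lp ℝ p (volume : Measure T3)}
    (h : TendstoWeakly b l a) (hb : ∀ᶠ i in l, invCNorm (b i) < ⊤) {r : ℝ}
    (hr : r < (invCNorm a).toReal) : ∀ᶠ i in l, r < (invCNorm (b i)).toReal := by
  by_contra hcon
  rw [not_eventually] at hcon
  have hfreq := hcon.and_eventually hb
  have hr0 : 0 < r := by
    obtain ⟨i, hi, hi_top⟩ := hfreq.exists
    exact (ENNReal.toReal_pos (invCNorm_pos _).ne' hi_top.ne).trans_le (not_lt.mp hi)
  have ha : invCNorm a < ⊤ := (ENNReal.toReal_pos_iff.mp (hr0.trans hr)).2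
  obtain ⟨z, hz⟩ := exists_ae_eq_of_invCNorm_lt_top ha
  have := posSMulMono_Lp (μ := (volume : Measure T3)) (p := p)
  have hsign : ∃ᶠ i in l, Lp.const p volume r⁻¹ ≤ b i ∨ b i ≤ Lp.const p volume (-r⁻¹) := by
    refine hfreq.mono fun i ⟨hi, hi_top⟩ => ?_
    obtain ⟨w, hw⟩ := exists_ae_eq_of_invCNorm_lt_top hi_top
    exact (invCNorm_le_ofReal_iff_const_le_or_le_const hw hr0).mp
      ((ENNReal.le_ofReal_iff_toReal_le hi_top.ne hr0.le).mpr (not_lt.mp hi))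
  have hle : invCNorm a ≤ ENNReal.ofReal r :=
    (invCNorm_le_ofReal_iff_const_le_or_le_const hz hr0).mpr <|
      (frequently_or_distrib.mp hsign).imp
        (h.mem_of_frequently (convex_Ici _) isClosed_Ici)
        (h.mem_of_frequently (convex_Iic _) isClosed_Iic)
  exact hr.not_ge ((ENNReal.le_ofReal_iff_toReal_le ha.ne hr0.le).mp hle)

end InvCNorm

namespace Sobolev

variable {k : ℕ} {p : ℝ≥0∞} [Fact (1 ≤ p)]

section Representative

variable {E : Type*} [NormedAddCommGroup E] [NormedSpace ℝ E] [CompleteSpace E]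

theorem exists_dist_le (hkp : 3 / p.toReal < k) :
    ∃ C : ℝ, 0 < C ∧ ∀ (v v' : Sobolev k p E) (w w' : C(T3, E)), fn v =ᵐ[volume] w →
      fn v' =ᵐ[volume] w' → dist w w' ≤ C * dist v v' := by
  obtain ⟨C, hC0, hC⟩ := exists_norm_le (p := p) (E := E) hkp
  refine ⟨C, hC0, fun v v' w w' h h' => ?_⟩
  have hsub : fn (v - v') =ᵐ[volume] (w - w' : C(T3, E)) :=
    (Lp.coeFn_sub (v.1 (MultiIdx.zero k)) (v'.1 (MultiIdx.zero k))).trans (h.sub h')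
  rw [dist_eq_norm, dist_eq_norm, ContinuousMap.norm_le _ (by positivity)]
  exact hC _ _ hsub

theorem exists_tendsto_representative (hkp : 3 / p.toReal < k) {b : ℕ → Sobolev k p E}
    {a : Sobolev k p E} (hba : Tendsto b atTop (𝓝 a)) {w : ℕ → C(T3, E)}
    (hw : ∀ n, fn (b n) =ᵐ[volume] w n) :
    ∃ z : C(T3, E), fn a =ᵐ[volume] z ∧ Tendsto w atTop (𝓝 z) := by
  obtain ⟨C, _, hC⟩ := exists_dist_le (p := p) (E := E) hkp
  have hcauchy : CauchySeq w := by
    have hdist := (cauchySeq_iff_tendsto_dist_atTop_0.mp hba.cauchySeq).const_mul C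
    rw [mul_zero] at hdist
    exact cauchySeq_iff_tendsto_dist_atTop_0.mpr <|
      squeeze_zero (fun _ => dist_nonneg) (fun _ => hC _ _ _ _ (hw _) (hw _)) hdist
  obtain ⟨z, hz⟩ := cauchySeq_tendsto_of_complete hcauchy
  have hLp : ∀ n, ContinuousMap.toLp (E := E) p volume ℝ (w n) = (b n).1 (MultiIdx.zero k) :=
    fun n => Lp.ext ((ContinuousMap.coeFn_toLp (p := p) (𝕜 := ℝ) volume (w n)).trans (hw n).symm)
  have hlim : (a.1 (MultiIdx.zero k)) = ContinuousMap.toLp (E := E) p volume ℝ z :=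
    tendsto_nhds_unique
      ((((PiLp.continuous_apply p _ (MultiIdx.zero k)).comp continuous_subtype_val).tendsto a).comp
        hba)
      ((((ContinuousMap.toLp (E := E) p volume ℝ).continuous.tendsto z).comp hz).congr hLp)
  refine ⟨z, ?_, hz⟩
  rw [fn, hlim]
  exact ContinuousMap.coeFn_toLp volume z

end Representative

theorem invCNorm_fn_le_of_tendsto (hkp : 3 / p.toReal < k) {b : ℕ → Sobolev k p ℝ}
    {a : Sobolev k p ℝ} (hba : Tendsto b atTop (𝓝 a)) {r : ℝ} (hr : 0 < r)
    (h : ∀ n, invCNorm (fn (b n)) ≤ ENNReal.ofReal r) :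
    invCNorm (fn a) ≤ ENNReal.ofReal r := by
  choose w hw using fun n =>
    exists_ae_eq_of_invCNorm_lt_top ((h n).trans_lt ENNReal.ofReal_lt_top)
  obtain ⟨z, hz, hwz⟩ := exists_tendsto_representative hkp hba hw
  refine (invCNorm_le_ofReal_iff_of_ae hz hr).mpr fun x => ?_
  exact ge_of_tendsto' (((continuous_eval_const x).tendsto z).comp hwz).abs
    fun n => (invCNorm_le_ofReal_iff_of_ae (hw n) hr).mp (h n) x

variable {ι : Type*} {l : Filter ι} {b : ι → Sobolev k p ℝ} {a : Sobolev k p ℝ}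

theorem eventually_invCNorm_fn_le (hkp : 3 / p.toReal < k) (hba : Tendsto b l (𝓝 a)) {r : ℝ}
    (hb : ∀ᶠ i in l, invCNorm (fn (b i)) < ⊤) (ha : invCNorm (fn a) < ENNReal.ofReal r) :
    ∀ᶠ i in l, invCNorm (fn (b i)) ≤ ENNReal.ofReal r := by
  obtain ⟨C, hC0, hC⟩ := exists_dist_le (p := p) (E := ℝ) hkp
  have ha_top : invCNorm (fn a) < ⊤ := ha.trans ENNReal.ofReal_lt_top
  obtain ⟨z, hz⟩ := exists_ae_eq_of_invCNorm_lt_top ha_top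
  set s := (invCNorm (fn a)).toReal with hs
  have hs0 : 0 < s := ENNReal.toReal_pos (invCNorm_pos _).ne' ha_top.ne
  have hsr : s < r := (ENNReal.lt_ofReal_iff_toReal_lt ha_top.ne).mp ha
  have hzs : ∀ x, s⁻¹ ≤ |z x| := (invCNorm_le_ofReal_iff_of_ae hz hs0).mp
    ((ENNReal.le_ofReal_iff_toReal_le ha_top.ne hs0.le).mpr hs.ge)
  have hgap : 0 < s⁻¹ - r⁻¹ := sub_pos.mpr (inv_strictAnti₀ hs0 hsr)
  filter_upwards [hb, Metric.tendsto_nhds.mp hba ((s⁻¹ - r⁻¹) / C) (by positivity)]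
    with i hi hdist
  obtain ⟨w, hw⟩ := exists_ae_eq_of_invCNorm_lt_top hi
  refine (invCNorm_le_ofReal_iff_of_ae hw (hs0.trans hsr)).mpr fun x => ?_
  have hwz : |w x - z x| ≤ s⁻¹ - r⁻¹ :=
    calc |w x - z x| = dist (w x) (z x) := (Real.dist_eq _ _).symm
      _ ≤ dist w z := ContinuousMap.dist_apply_le_dist x
      _ ≤ C * dist (b i) a := hC _ _ _ _ hw hz
      _ ≤ C * ((s⁻¹ - r⁻¹) / C) := by gcongr
      _ = s⁻¹ - r⁻¹ := mul_div_cancel₀ _ hC0.ne'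
  have habs := abs_sub_abs_le_abs_sub (z x) (w x)
  rw [abs_sub_comm] at habs
  linarith [hzs x]

theorem eventually_lt_invCNorm_fn (hp : 2 ≤ p)
    (h : TendstoWeakly (fun i => toL2 hp (b i)) l (toL2 hp a))
    (hb : ∀ᶠ i in l, invCNorm (fn (b i)) < ⊤) {r : ℝ} (hr : r < (invCNorm (fn a)).toReal) :
    ∀ᶠ i in l, r < (invCNorm (fn (b i))).toReal := by
  simp only [← invCNorm_congr_ae (coeFn_toL2 hp _)] at hb hr ⊢
  exact h.eventually_lt_invCNorm hb hr

theorem tendsto_invCNorm_fn (hp : 2 ≤ p) (hkp : 3 / p.toReal < k) (hba : Tendsto b l (𝓝 a))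
    (hb : ∀ᶠ i in l, invCNorm (fn (b i)) < ⊤) (ha : invCNorm (fn a) < ⊤) :
    Tendsto (fun i => (invCNorm (fn (b i))).toReal) l (𝓝 (invCNorm (fn a)).toReal) := by
  rw [tendsto_order]
  refine ⟨fun r hr => eventually_lt_invCNorm_fn hp
    ((tendstoWeakly_of_tendsto hba).map (toL2 hp)) hb hr, fun r hr => ?_⟩
  obtain ⟨s, hs, hsr⟩ := exists_between hr
  filter_upwards [eventually_invCNorm_fn_le hkp hba hb
    ((ENNReal.lt_ofReal_iff_toReal_lt ha.ne).mpr hs)] with i hi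
  exact (ENNReal.toReal_le_of_le_ofReal (ENNReal.toReal_nonneg.trans hs.le) hi).trans_lt hsr

end Sobolev

/-! ### The phase space inside `L²(𝕋³; ℂ⁵)` -/

section Coordinates

/-- The embedding of `ℝ` into the `j`-th coordinate of `ℂ⁵`. -/
noncomputable def coordEmb (j : Fin 5) : ℝ →L[ℝ] EuclideanSpace ℂ (Fin 5) :=
  ContinuousLinearMap.toSpanSingleton ℝ (EuclideanSpace.single j (1 : ℂ))

/-- The embedding of `ℝ³` into the last three coordinates of `ℂ⁵`. -/
noncomputable def velocityEmb : EuclideanSpace ℝ (Fin 3) →L[ℝ] EuclideanSpace ℂ (Fin 5) :=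
  (coordEmb 2).comp (EuclideanSpace.proj 0) + (coordEmb 3).comp (EuclideanSpace.proj 1) +
    (coordEmb 4).comp (EuclideanSpace.proj 2)

/-- The real part of the `j`-th coordinate of a vector of `ℂ⁵`. -/
noncomputable def rePart (j : Fin 5) : EuclideanSpace ℂ (Fin 5) →L[ℝ] ℝ :=
  Complex.reCLM.comp ((EuclideanSpace.proj j : EuclideanSpace ℂ (Fin 5) →L[ℂ] ℂ).restrictScalars ℝ)

/-- The real parts of the last three coordinates of a vector of `ℂ⁵`. -/
noncomputable def velocityPart : EuclideanSpace ℂ (Fin 5) →L[ℝ] EuclideanSpace ℝ (Fin 3) :=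
  (EuclideanSpace.equiv (Fin 3) ℝ).symm.toContinuousLinearMap.comp
    (ContinuousLinearMap.pi ![rePart 2, rePart 3, rePart 4])

theorem coordEmb_apply (j : Fin 5) (r : ℝ) (i : Fin 5) :
    coordEmb j r i = if i = j then (r : ℂ) else 0 := by
  rw [coordEmb, ContinuousLinearMap.toSpanSingleton_apply, PiLp.smul_apply, PiLp.single_apply]
  split_ifs <;> simp

theorem velocityEmb_apply (u : EuclideanSpace ℝ (Fin 3)) (i : Fin 5) :
    velocityEmb u i = (if i = 2 then (u 0 : ℂ) else 0) + (if i = 3 then (u 1 : ℂ) else 0) +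
      if i = 4 then (u 2 : ℂ) else 0 := by
  simp [velocityEmb, coordEmb_apply]

theorem rePart_apply (j : Fin 5) (z : EuclideanSpace ℂ (Fin 5)) : rePart j z = (z j).re := rfl

theorem velocityPart_apply (z : EuclideanSpace ℂ (Fin 5)) :
    velocityPart z = !₂[(z 2).re, (z 3).re, (z 4).re] := by
  ext j
  fin_cases j <;> rfl

end Coordinates

namespace PhaseSpace

variable {q : ℝ≥0∞} [Fact (1 ≤ q)]

theorem norm_eq (U : PhaseSpace q) : ‖U‖ = ‖U.fst‖ + (‖U.snd.fst‖ + ‖U.snd.snd‖) := by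
  rw [WithLp.prod_norm_eq_of_L1, WithLp.prod_norm_eq_of_L1]

theorem ext_components {U V : PhaseSpace q} (hfst : U.fst = V.fst)
    (hsnd_fst : U.snd.fst = V.snd.fst) (hsnd_snd : U.snd.snd = V.snd.snd) : U = V := by
  rw [← dist_eq_zero, WithLp.prod_dist_eq_of_L1, WithLp.prod_dist_eq_of_L1, hfst, hsnd_fst,
    hsnd_snd, dist_self, dist_self, dist_self, add_zero, add_zero]

theorem norm_le_size (U : PhaseSpace q) : ‖U‖ ≤ U.size := by
  rw [size, add_assoc]
  exact le_add_of_nonneg_right (add_nonneg ENNReal.toReal_nonneg ENNReal.toReal_nonneg)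

theorem size_nonneg (U : PhaseSpace q) : 0 ≤ U.size := (norm_nonneg U).trans U.norm_le_size

/-- The projection `(ϱ, ϑ, u) ↦ ϱ`. -/
noncomputable def densityL : PhaseSpace q →L[ℝ] Sobolev 1 q ℝ :=
  WithLp.fstL 1 ℝ _ _

/-- The projection `(ϱ, ϑ, u) ↦ ϑ`. -/
noncomputable def temperatureL : PhaseSpace q →L[ℝ] Sobolev 2 2 ℝ :=
  (WithLp.fstL 1 ℝ _ _).comp (WithLp.sndL 1 ℝ _ _)

/-- The projection `(ϱ, ϑ, u) ↦ u`. -/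
noncomputable def velocityL : PhaseSpace q →L[ℝ] Sobolev 2 2 (EuclideanSpace ℝ (Fin 3)) :=
  (WithLp.sndL 1 ℝ _ _).comp (WithLp.sndL 1 ℝ _ _)

theorem tendsto_iff {ι : Type*} {l : Filter ι} {u : ι → PhaseSpace q} {U : PhaseSpace q} :
    Tendsto u l (𝓝 U) ↔ Tendsto (fun i => (u i).fst) l (𝓝 U.fst) ∧
      Tendsto (fun i => (u i).snd.fst) l (𝓝 U.snd.fst) ∧
        Tendsto (fun i => (u i).snd.snd) l (𝓝 U.snd.snd) := by
  constructor
  · exact fun h => ⟨(densityL.continuous.tendsto U).comp h,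
      (temperatureL.continuous.tendsto U).comp h, (velocityL.continuous.tendsto U).comp h⟩
  · rintro ⟨hdensity, htemperature, hvelocity⟩
    rw [tendsto_iff_dist_tendsto_zero] at hdensity htemperature hvelocity ⊢
    simp only [WithLp.prod_dist_eq_of_L1]
    simpa only [add_zero] using hdensity.add (htemperature.add hvelocity)

/-- The class of `(ϱ, ϑ, u)` in `L²(𝕋³; ℂ⁵)`. -/
noncomputable def toL2C5 (hq : 2 ≤ q) : PhaseSpace q →L[ℝ] L2C5 :=
  ((coordEmb 0).compLpL 2 volume).comp ((Sobolev.toL2 hq).comp densityL) +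
  ((coordEmb 1).compLpL 2 volume).comp ((Sobolev.toL2 le_rfl).comp temperatureL) +
  (velocityEmb.compLpL 2 volume).comp ((Sobolev.toL2 le_rfl).comp velocityL)

theorem toL2C5_apply (hq : 2 ≤ q) (U : PhaseSpace q) :
    toL2C5 hq U = (coordEmb 0).compLpL 2 volume (Sobolev.toL2 hq U.fst) +
      (coordEmb 1).compLpL 2 volume (Sobolev.toL2 le_rfl U.snd.fst) +
        velocityEmb.compLpL 2 volume (Sobolev.toL2 le_rfl U.snd.snd) := rfl

theorem toL2C5_apply_ae (hq : 2 ≤ q) (U : PhaseSpace q) :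
    ∀ᵐ x, ∀ j, toL2C5 hq U x j = (U.vec x j : ℂ) := by
  rw [toL2C5_apply]
  filter_upwards [Lp.coeFn_add ((coordEmb 0).compLpL 2 volume (Sobolev.toL2 hq U.fst) +
      (coordEmb 1).compLpL 2 volume (Sobolev.toL2 le_rfl U.snd.fst))
      (velocityEmb.compLpL 2 volume (Sobolev.toL2 le_rfl U.snd.snd)),
    Lp.coeFn_add ((coordEmb 0).compLpL 2 volume (Sobolev.toL2 hq U.fst))
      ((coordEmb 1).compLpL 2 volume (Sobolev.toL2 le_rfl U.snd.fst)),
    (coordEmb 0).coeFn_compLpL (Sobolev.toL2 hq U.fst), Sobolev.coeFn_toL2 hq U.fst,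
    (coordEmb 1).coeFn_compLpL (Sobolev.toL2 le_rfl U.snd.fst), Sobolev.coeFn_toL2 le_rfl U.snd.fst,
    velocityEmb.coeFn_compLpL (Sobolev.toL2 le_rfl U.snd.snd), Sobolev.coeFn_toL2 le_rfl U.snd.snd]
    with x hadd hadd' hdensity hfn hdensity' hfn' hvelocity hfn_velocity j
  rw [hadd, Pi.add_apply, hadd', Pi.add_apply, hdensity, hdensity', hvelocity, hfn, hfn',
    hfn_velocity]
  simp only [PiLp.add_apply, coordEmb_apply, velocityEmb_apply, vec, density, temperature, velocity]
  fin_cases j <;> simp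

section Components

variable (hq : 2 ≤ q) (U : PhaseSpace q)

theorem compLpL_rePart_zero_toL2C5 :
    (rePart 0).compLpL 2 volume (toL2C5 hq U) = Sobolev.toL2 hq U.fst := by
  refine Lp.ext ?_
  filter_upwards [(rePart 0).coeFn_compLpL (toL2C5 hq U), toL2C5_apply_ae hq U,
    Sobolev.coeFn_toL2 hq U.fst] with x hcomp hvec hfn
  rw [hcomp, hfn, rePart_apply, hvec]
  rfl

theorem compLpL_rePart_one_toL2C5 :
    (rePart 1).compLpL 2 volume (toL2C5 hq U) = Sobolev.toL2 le_rfl U.snd.fst := by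
  refine Lp.ext ?_
  filter_upwards [(rePart 1).coeFn_compLpL (toL2C5 hq U), toL2C5_apply_ae hq U,
    Sobolev.coeFn_toL2 le_rfl U.snd.fst] with x hcomp hvec hfn
  rw [hcomp, hfn, rePart_apply, hvec]
  rfl

theorem compLpL_velocityPart_toL2C5 :
    velocityPart.compLpL 2 volume (toL2C5 hq U) = Sobolev.toL2 le_rfl U.snd.snd := by
  refine Lp.ext ?_
  filter_upwards [velocityPart.coeFn_compLpL (toL2C5 hq U), toL2C5_apply_ae hq U,
    Sobolev.coeFn_toL2 le_rfl U.snd.snd] with x hcomp hvec hfn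
  rw [hcomp, hfn, velocityPart_apply, hvec, hvec, hvec]
  ext j
  fin_cases j <;> rfl

end Components

theorem toL2C5_injective (hq : 2 ≤ q) : Function.Injective (toL2C5 hq : PhaseSpace q → L2C5) :=
  fun U V h => ext_components
    (Sobolev.toL2_injective hq (by
      rw [← compLpL_rePart_zero_toL2C5, ← compLpL_rePart_zero_toL2C5, h]))
    (Sobolev.toL2_injective le_rfl (by
      rw [← compLpL_rePart_one_toL2C5 hq, ← compLpL_rePart_one_toL2C5 hq, h]))
    (Sobolev.toL2_injective le_rfl (by
      rw [← compLpL_velocityPart_toL2C5 hq, ← compLpL_velocityPart_toL2C5 hq, h]))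

section Fourier

variable (hq : 2 ≤ q) (e : HilbertBasis (Fin 5 → ℤ) ℂ L2C5)
include hq

theorem fourierF_eq_inner (k : Fin 5 → ℤ) (U : PhaseSpace q) :
    fourierF e k U = inner ℂ (toL2C5 hq U) (e k) := by
  rw [fourierF, L2.inner_def]
  refine integral_congr_ae ?_
  filter_upwards [toL2C5_apply_ae hq U] with x hx
  rw [PiLp.inner_apply]
  refine Finset.sum_congr rfl fun j _ => ?_
  rw [RCLike.inner_apply', hx j, Complex.conj_ofReal]

theorem continuous_fourierF (k : Fin 5 → ℤ) : Continuous (fourierF e k : PhaseSpace q → ℂ) := by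
  rw [funext (fourierF_eq_inner hq e k)]
  exact (toL2C5 hq).continuous.inner continuous_const

theorem norm_fourierF_le (k : Fin 5 → ℤ) (U : PhaseSpace q) :
    ‖fourierF e k U‖ ≤ ‖toL2C5 hq‖ * ‖U‖ := by
  rw [fourierF_eq_inner hq]
  refine (norm_inner_le_norm _ _).trans ?_
  rw [e.orthonormal.1 k, mul_one]
  exact (toL2C5 hq).le_opNorm U

theorem eq_of_fourierF_eq {U V : PhaseSpace q} (h : ∀ k, fourierF e k U = fourierF e k V) :
    U = V := by
  refine toL2C5_injective hq (e.repr.injective ?_)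
  ext k
  rw [e.repr_apply_apply, e.repr_apply_apply, ← inner_conj_symm, ← inner_conj_symm (e k),
    ← fourierF_eq_inner, ← fourierF_eq_inner, h]

theorem tendstoWeakly_toL2C5 {ι : Type*} {l : Filter ι} {u : ι → PhaseSpace q} {U : PhaseSpace q}
    {C : ℝ} (hC : ∀ᶠ i in l, ‖u i‖ ≤ C)
    (h : ∀ k, Tendsto (fun i => fourierF e k (u i)) l (𝓝 (fourierF e k U))) :
    TendstoWeakly (fun i => toL2C5 hq (u i)) l (toL2C5 hq U) := by
  refine tendstoWeakly_of_dense_span (𝕜 := ℂ) (C := ‖toL2C5 hq‖ * C) (s := Set.range e) ?_ ?_ ?_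
  · filter_upwards [hC] with i hi
    refine ((toL2C5 hq).le_opNorm _).trans ?_
    gcongr
  · rw [Submodule.dense_iff_topologicalClosure_eq_top]
    exact e.dense_span
  · rintro _ ⟨k, rfl⟩
    have hconj := (Complex.continuous_conj.tendsto _).comp (h k)
    simp only [fourierF_eq_inner hq, Function.comp_def] at hconj
    simpa only [inner_conj_symm] using hconj

end Fourier

end PhaseSpace

theorem tendsto_of_tendsto_sum_of_forall_eventually_lt {ι J : Type*} [Fintype J] {l : Filter ι}
    {x : J → ι → ℝ} {a : J → ℝ} (h : ∀ j, ∀ c < a j, ∀ᶠ i in l, c < x j i)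
    (hsum : Tendsto (fun i => ∑ j, x j i) l (𝓝 (∑ j, a j))) (j : J) :
    Tendsto (x j) l (𝓝 (a j)) := by
  have hmin : ∀ j, Tendsto (fun i => min (x j i) (a j)) l (𝓝 (a j)) := fun j =>
    tendsto_min_of_forall_eventually_lt (h j)
  have hexcess_nonneg : ∀ j i, 0 ≤ x j i - min (x j i) (a j) := fun j i =>
    sub_nonneg.mpr (min_le_left _ _)
  have hexcess_sum : Tendsto (fun i => ∑ j, (x j i - min (x j i) (a j))) l (𝓝 0) := by
    simp only [Finset.sum_sub_distrib]
    simpa only [sub_self] using hsum.sub (tendsto_finsetSum Finset.univ fun j _ => hmin j)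
  have hexcess : Tendsto (fun i => x j i - min (x j i) (a j)) l (𝓝 0) :=
    squeeze_zero (hexcess_nonneg j) (fun i => Finset.single_le_sum
      (f := fun j => x j i - min (x j i) (a j)) (fun j _ => hexcess_nonneg j i)
      (Finset.mem_univ j)) hexcess_sum
  simpa only [sub_add_cancel, zero_add] using hexcess.add (hmin j)

theorem two_le_of_three_lt {q : ℝ≥0∞} (hq3 : 3 < q) : 2 ≤ q :=
  (show (2 : ℝ≥0∞) ≤ 3 by norm_num).trans hq3.le

theorem three_div_toReal_lt_one {q : ℝ≥0∞} (hq3 : 3 < q) (hq_top : q ≠ ⊤) :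
    3 / q.toReal < (1 : ℕ) := by
  have h : 3 < q.toReal := by
    simpa using (ENNReal.toReal_lt_toReal (by simp) hq_top).mpr hq3
  rwa [Nat.cast_one, div_lt_one (by linarith)]

theorem three_div_two_lt_two : 3 / (2 : ℝ≥0∞).toReal < (2 : ℕ) := by norm_num

namespace PhaseSpace

variable {q : ℝ≥0∞} [Fact (1 ≤ q)]

theorem norm_fst_le (U : PhaseSpace q) : ‖U.fst‖ ≤ ‖U‖ := by
  rw [norm_eq]
  exact le_add_of_nonneg_right (by positivity)

theorem norm_snd_fst_le (U : PhaseSpace q) : ‖U.snd.fst‖ ≤ ‖U‖ := by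
  rw [norm_eq]
  linarith [norm_nonneg U.fst, norm_nonneg U.snd.snd]

theorem norm_snd_snd_le (U : PhaseSpace q) : ‖U.snd.snd‖ ≤ ‖U‖ := by
  rw [norm_eq]
  linarith [norm_nonneg U.fst, norm_nonneg U.snd.fst]

theorem size_eq_sum (U : PhaseSpace q) : U.size =
    ∑ j, ![‖U.fst‖, ‖U.snd.fst‖, ‖U.snd.snd‖, (invCNorm U.density).toReal,
      (invCNorm U.temperature).toReal] j := by
  rw [size, norm_eq, Fin.sum_univ_five, ← add_assoc]
  rfl

theorem invCNorm_le_size {U : PhaseSpace q} (hU : U ∈ XPlus q) :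
    invCNorm U.density ≤ ENNReal.ofReal U.size ∧
      invCNorm U.temperature ≤ ENNReal.ofReal U.size := by
  rw [ENNReal.le_ofReal_iff_toReal_le hU.1.ne U.size_nonneg,
    ENNReal.le_ofReal_iff_toReal_le hU.2.ne U.size_nonneg, size]
  have hdensity : 0 ≤ (invCNorm U.density).toReal := ENNReal.toReal_nonneg
  have htemperature : 0 ≤ (invCNorm U.temperature).toReal := ENNReal.toReal_nonneg
  constructor <;> linarith [norm_nonneg U]

section SizeConvergence

variable {ι : Type*} {l : Filter ι} {u : ι → PhaseSpace q} {U : PhaseSpace q}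

theorem tendsto_size (hq3 : 3 < q) (hq_top : q ≠ ⊤) (hu : ∀ᶠ i in l, u i ∈ XPlus q)
    (hU : U ∈ XPlus q) (h : Tendsto u l (𝓝 U)) : Tendsto (fun i => (u i).size) l (𝓝 U.size) := by
  obtain ⟨hdensity, htemperature, -⟩ := tendsto_iff.mp h
  exact (h.norm.add (Sobolev.tendsto_invCNorm_fn (two_le_of_three_lt hq3)
    (three_div_toReal_lt_one hq3 hq_top) hdensity (hu.mono fun i hi => hi.1) hU.1)).add
      (Sobolev.tendsto_invCNorm_fn le_rfl three_div_two_lt_two htemperature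
        (hu.mono fun i hi => hi.2) hU.2)

-- Each of the five summands of the size is weakly lower semicontinuous, so none of them can drop
-- in the limit once their sum converges.
theorem tendsto_of_tendsto_size (hq : 2 ≤ q) (hq_top : q ≠ ⊤)
    (e : HilbertBasis (Fin 5 → ℤ) ℂ L2C5) (hu : ∀ᶠ i in l, u i ∈ XPlus q)
    (hsize : Tendsto (fun i => (u i).size) l (𝓝 U.size))
    (h : ∀ k, Tendsto (fun i => fourierF e k (u i)) l (𝓝 (fourierF e k U))) :
    Tendsto u l (𝓝 U) := by
  have htwo : (2 : ℝ≥0∞) ≠ ⊤ := by simp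
  have hC : ∀ᶠ i in l, ‖u i‖ ≤ U.size + 1 := by
    filter_upwards [hsize.eventually (gt_mem_nhds (lt_add_one U.size))] with i hi
    exact (u i).norm_le_size.trans hi.le
  have hweak := tendstoWeakly_toL2C5 hq e hC h
  have hdensity := hweak.map ((rePart 0).compLpL 2 volume)
  have htemperature := hweak.map ((rePart 1).compLpL 2 volume)
  have hvelocity := hweak.map (velocityPart.compLpL 2 volume)
  simp only [compLpL_rePart_zero_toL2C5, compLpL_rePart_one_toL2C5,
    compLpL_velocityPart_toL2C5] at hdensity htemperature hvelocity
  simp only [size_eq_sum] at hsize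
  have hsummand := tendsto_of_tendsto_sum_of_forall_eventually_lt
    (x := fun j i => ![‖(u i).fst‖, ‖(u i).snd.fst‖, ‖(u i).snd.snd‖,
      (invCNorm (u i).density).toReal, (invCNorm (u i).temperature).toReal] j) (fun j c hc => by
    fin_cases j
    · exact Sobolev.eventually_lt_norm hq hq_top (hC.mono fun i => (u i).norm_fst_le.trans)
        hdensity hc
    · exact Sobolev.eventually_lt_norm le_rfl htwo (hC.mono fun i => (u i).norm_snd_fst_le.trans)
        htemperature hc
    · exact Sobolev.eventually_lt_norm le_rfl htwo (hC.mono fun i => (u i).norm_snd_snd_le.trans)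
        hvelocity hc
    · exact Sobolev.eventually_lt_invCNorm_fn hq hdensity (hu.mono fun i hi => hi.1) hc
    · exact Sobolev.eventually_lt_invCNorm_fn le_rfl htemperature (hu.mono fun i hi => hi.2) hc)
    hsize
  exact tendsto_iff.mpr
    ⟨Sobolev.tendsto_of_tendstoWeakly_of_tendsto_norm hq hq_top (hsummand 0) hdensity,
      Sobolev.tendsto_of_tendstoWeakly_of_tendsto_norm le_rfl htwo (hsummand 1) htemperature,
      Sobolev.tendsto_of_tendstoWeakly_of_tendsto_norm le_rfl htwo (hsummand 2) hvelocity⟩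

end SizeConvergence

theorem mem_XPlus_of_tendsto (hq3 : 3 < q) (hq_top : q ≠ ⊤) {u : ℕ → PhaseSpace q}
    {U : PhaseSpace q} {C : ℝ} (hu : ∀ᶠ n in atTop, u n ∈ XPlus q ∧ (u n).size ≤ C)
    (h : Tendsto u atTop (𝓝 U)) : U ∈ XPlus q := by
  obtain ⟨N, hN⟩ := eventually_atTop.mp hu
  obtain ⟨hdensity, htemperature, -⟩ := tendsto_iff.mp ((tendsto_add_atTop_iff_nat N).mpr h)
  have hbound : ∀ n, invCNorm (u (n + N)).density ≤ ENNReal.ofReal (|C| + 1) ∧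
      invCNorm (u (n + N)).temperature ≤ ENNReal.ofReal (|C| + 1) := by
    intro n
    obtain ⟨hmem, hle⟩ := hN (n + N) (Nat.le_add_left _ _)
    have hofReal : ENNReal.ofReal (u (n + N)).size ≤ ENNReal.ofReal (|C| + 1) :=
      ENNReal.ofReal_le_ofReal (by linarith [le_abs_self C])
    exact (invCNorm_le_size hmem).imp hofReal.trans' hofReal.trans'
  have hC : 0 < |C| + 1 := by positivity
  exact ⟨(Sobolev.invCNorm_fn_le_of_tendsto (three_div_toReal_lt_one hq3 hq_top) hdensity hC
      fun n => (hbound n).1).trans_lt ENNReal.ofReal_lt_top,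
    (Sobolev.invCNorm_fn_le_of_tendsto three_div_two_lt_two htemperature hC
      fun n => (hbound n).2).trans_lt ENNReal.ofReal_lt_top⟩

end PhaseSpace

/-! ### The weight `G` -/

namespace XPlusInf

variable {q : ℝ≥0∞} [Fact (1 ≤ q)]

theorem zero_notMem_XPlus : (0 : PhaseSpace q) ∉ XPlus q := fun h =>
  h.1.ne (invCNorm_eq_top_of_ae_eq_zero (Lp.coeFn_zero ℝ q volume))

theorem eq_infty_of_notMem {U : XPlusInf q} (h : U.toX ∉ XPlus q) : U = infty q :=
  Subtype.ext (U.2.resolve_left h : U.1 = 0)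

theorem weight_of_mem {U : XPlusInf q} (h : U.toX ∈ XPlus q) :
    U.weight = ((1 + U.toX.size) ^ 2)⁻¹ := if_pos h

theorem weight_of_notMem {U : XPlusInf q} (h : U.toX ∉ XPlus q) : U.weight = 0 := if_neg h

@[simp] theorem weight_infty : (infty q).weight = 0 := weight_of_notMem zero_notMem_XPlus

theorem weight_pos_of_mem {U : XPlusInf q} (h : U.toX ∈ XPlus q) : 0 < U.weight := by
  have := U.toX.size_nonneg
  rw [weight_of_mem h]
  positivity

theorem weight_pos_iff {U : XPlusInf q} : 0 < U.weight ↔ U.toX ∈ XPlus q :=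
  ⟨fun h => by_contra fun hU => h.ne' (weight_of_notMem hU), weight_pos_of_mem⟩

theorem weight_nonneg (U : XPlusInf q) : 0 ≤ U.weight := by
  by_cases h : U.toX ∈ XPlus q
  · exact (weight_pos_of_mem h).le
  · exact (weight_of_notMem h).ge

theorem eq_infty_of_weight_eq_zero {U : XPlusInf q} (h : U.weight = 0) : U = infty q :=
  eq_infty_of_notMem fun hU => (weight_pos_of_mem hU).ne' h

theorem eq_of_weight_eq {U V : XPlusInf q} (hweight : U.weight = V.weight)
    (h : U.weight ≠ 0 → U.toX = V.toX) : U = V := by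
  by_cases h0 : U.weight = 0
  · rw [eq_infty_of_weight_eq_zero h0, eq_infty_of_weight_eq_zero (hweight.symm.trans h0)]
  · exact Subtype.ext (h h0)

theorem sqrt_weight_of_mem {U : XPlusInf q} (h : U.toX ∈ XPlus q) :
    √U.weight = (1 + U.toX.size)⁻¹ := by
  rw [weight_of_mem h, Real.sqrt_inv, Real.sqrt_sq (add_nonneg zero_le_one U.toX.size_nonneg)]

theorem size_eq_of_mem {U : XPlusInf q} (h : U.toX ∈ XPlus q) :
    U.toX.size = (√U.weight)⁻¹ - 1 := by
  rw [sqrt_weight_of_mem h, inv_inv, add_sub_cancel_left]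

theorem weight_mul_norm_le (U : XPlusInf q) : U.weight * ‖U.toX‖ ≤ √U.weight := by
  by_cases h : U.toX ∈ XPlus q
  · have hsize := U.toX.size_nonneg
    calc U.weight * ‖U.toX‖ ≤ ((1 + U.toX.size) ^ 2)⁻¹ * (1 + U.toX.size) := by
          rw [weight_of_mem h]
          gcongr
          linarith [U.toX.norm_le_size]
      _ = √U.weight := by
          rw [sqrt_weight_of_mem h]
          field_simp
  · rw [weight_of_notMem h, zero_mul, Real.sqrt_zero]

section Limits

variable {ι : Type*} {l : Filter ι} {u : ι → XPlusInf q}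

theorem tendsto_sqrt_weight_zero (h : Tendsto (fun i => (u i).weight) l (𝓝 0)) :
    Tendsto (fun i => √(u i).weight) l (𝓝 0) := by
  simpa only [Real.sqrt_zero] using h.sqrt

theorem tendsto_weight_smul_zero (h : Tendsto (fun i => (u i).weight) l (𝓝 0)) :
    Tendsto (fun i => (u i).weight • (u i).toX) l (𝓝 0) := by
  refine squeeze_zero_norm (fun i => ?_) (tendsto_sqrt_weight_zero h)
  rw [norm_smul, Real.norm_of_nonneg (weight_nonneg _)]
  exact weight_mul_norm_le _

theorem tendsto_weight_zero_iff : Tendsto (fun i => (u i).weight) l (𝓝 0) ↔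
    ∀ M : ℝ, 0 < M → ∀ᶠ i in l, u i = infty q ∨ M < (u i).toX.size := by
  constructor
  · intro h M hM
    filter_upwards [(tendsto_sqrt_weight_zero h).eventually
      (gt_mem_nhds (show (0 : ℝ) < (1 + M)⁻¹ by positivity))] with i hi
    refine or_iff_not_imp_left.mpr fun hne => ?_
    rw [sqrt_weight_of_mem (not_imp_comm.mp eq_infty_of_notMem hne),
      inv_lt_inv₀ (by linarith [(u i).toX.size_nonneg]) (by linarith)] at hi
    linarith
  · refine fun h => tendsto_order.mpr
      ⟨fun c hc => Eventually.of_forall fun i => hc.trans_le (weight_nonneg _), fun ε hε => ?_⟩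
    filter_upwards [h ε⁻¹ (inv_pos.mpr hε)] with i hi
    by_cases hmem : (u i).toX ∈ XPlus q
    · have hsize := hi.resolve_left fun hu => (weight_pos_of_mem hmem).ne' (hu ▸ weight_infty)
      rw [weight_of_mem hmem, inv_lt_comm₀ (by have := (u i).toX.size_nonneg; positivity) hε]
      nlinarith [(u i).toX.size_nonneg]
    · rwa [weight_of_notMem hmem]

theorem tendsto_weight_of_tendsto_toX (hq3 : 3 < q) (hq_top : q ≠ ⊤) {U : XPlusInf q}
    (hU : U.toX ∈ XPlus q) (hu : ∀ᶠ i in l, (u i).toX ∈ XPlus q)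
    (h : Tendsto (fun i => (u i).toX) l (𝓝 U.toX)) :
    Tendsto (fun i => (u i).weight) l (𝓝 U.weight) := by
  have hne : (1 + U.toX.size) ^ 2 ≠ 0 := by have := U.toX.size_nonneg; positivity
  rw [weight_of_mem hU]
  refine (((PhaseSpace.tendsto_size hq3 hq_top hu hU h).const_add 1 |>.pow 2).inv₀ hne).congr' ?_
  filter_upwards [hu] with i hi using (weight_of_mem hi).symm

theorem eventually_mem_XPlus {g : ℝ} (hg : 0 < g)
    (h : Tendsto (fun i => (u i).weight) l (𝓝 g)) : ∀ᶠ i in l, (u i).toX ∈ XPlus q :=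
  (h.eventually (lt_mem_nhds hg)).mono fun _ => weight_pos_iff.mp

theorem tendsto_size_of_tendsto_weight {g : ℝ} (hg : 0 < g)
    (h : Tendsto (fun i => (u i).weight) l (𝓝 g)) :
    Tendsto (fun i => (u i).toX.size) l (𝓝 ((√g)⁻¹ - 1)) := by
  refine ((h.sqrt.inv₀ (Real.sqrt_pos.mpr hg).ne').sub_const 1).congr' ?_
  filter_upwards [eventually_mem_XPlus hg h] with i hi using (size_eq_of_mem hi).symm

end Limits

end XPlusInf

/-! ### The metric -/

section Summability

theorem summable_prod_fin {α : Type*} {f : α → ℝ} (hf_nonneg : ∀ a, 0 ≤ f a) (hf : Summable f)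
    (n : ℕ) : Summable fun k : Fin n → α => ∏ j, f (k j) := by
  induction n with
  | zero => exact Summable.of_finite
  | succ n ih =>
    rw [← (Fin.consEquiv fun _ : Fin (n + 1) => α).summable_iff]
    refine (hf.mul_of_nonneg ih hf_nonneg fun k =>
      Finset.prod_nonneg fun j _ => hf_nonneg _).congr fun k => ?_
    simp [Fin.consEquiv, Fin.prod_univ_succ]

theorem summable_exp_neg_mul_abs {c : ℝ} (hc : 0 < c) :
    Summable fun k : ℤ => Real.exp (-(c * |(k : ℝ)|)) := by
  have h : Summable fun n : ℕ => Real.exp (-(c * n)) := by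
    simpa only [mul_neg, mul_comm c] using
      Real.summable_exp_nat_mul_iff.mpr (neg_neg_iff_pos.mpr hc)
  exact Summable.of_nat_of_neg (by simpa using h) (by simpa using h)

theorem summable_exp_neg_sqrt_sum_sq (n : ℕ) :
    Summable fun k : Fin n → ℤ => Real.exp (-√(∑ j, (k j : ℝ) ^ 2)) := by
  have hc : (0 : ℝ) < ((n : ℝ) + 1)⁻¹ := by positivity
  refine Summable.of_nonneg_of_le (fun k => (Real.exp_pos _).le) (fun k => ?_)
    (summable_prod_fin (fun k => (Real.exp_pos _).le) (summable_exp_neg_mul_abs hc) n)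
  have habs : ∀ j, |(k j : ℝ)| ≤ √(∑ j, (k j : ℝ) ^ 2) := fun j =>
    Real.abs_le_sqrt (Finset.single_le_sum (f := fun j => (k j : ℝ) ^ 2)
      (fun i _ => sq_nonneg _) (Finset.mem_univ j))
  have hsum : ∑ j, ((n : ℝ) + 1)⁻¹ * |(k j : ℝ)| ≤ √(∑ j, (k j : ℝ) ^ 2) := by
    rw [← Finset.mul_sum, inv_mul_le_iff₀ (by positivity)]
    calc ∑ j, |(k j : ℝ)| ≤ n * √(∑ j, (k j : ℝ) ^ 2) := by
          simpa using Finset.sum_le_card_nsmul Finset.univ _ _ fun j _ => habs j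
      _ ≤ (n + 1) * √(∑ j, (k j : ℝ) ^ 2) := by gcongr; linarith
  rw [← Real.exp_sum, Real.exp_le_exp, Finset.sum_neg_distrib]
  exact neg_le_neg hsum

end Summability

section BoundedDistance

theorem div_one_add_le_add {s t r : ℝ} (hs : 0 ≤ s) (ht : 0 ≤ t) (hr : 0 ≤ r) (h : r ≤ s + t) :
    r / (1 + r) ≤ s / (1 + s) + t / (1 + t) := by
  calc r / (1 + r) ≤ (s + t) / (1 + (s + t)) := by
        rw [div_le_div_iff₀ (by linarith) (by linarith)]
        linarith
    _ = s / (1 + (s + t)) + t / (1 + (s + t)) := add_div _ _ _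
    _ ≤ s / (1 + s) + t / (1 + t) := by gcongr <;> linarith

theorem tendsto_div_one_add_zero_iff {ι : Type*} {l : Filter ι} {t : ι → ℝ} (ht : ∀ i, 0 ≤ t i) :
    Tendsto (fun i => t i / (1 + t i)) l (𝓝 0) ↔ Tendsto t l (𝓝 0) := by
  constructor
  · intro h
    have hinv := h.div (h.const_sub 1) (by norm_num)
    rw [zero_div] at hinv
    refine hinv.congr fun i => ?_
    have : 1 + t i ≠ 0 := by linarith [ht i]
    simp only [Pi.div_apply]
    field_simp
    ring
  · intro h
    simpa only [zero_div] using! h.div (h.const_add 1) (by norm_num)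

end BoundedDistance

/-- The weight `exp(-|k|)` of the index `(i, k)` in the series defining `d`. -/
noncomputable def phaseCoeff (ik : Fin 2 × (Fin 5 → ℤ)) : ℝ :=
  Real.exp (-√(∑ j, (ik.2 j : ℝ) ^ 2))

theorem phaseCoeff_pos (ik : Fin 2 × (Fin 5 → ℤ)) : 0 < phaseCoeff ik := Real.exp_pos _

theorem summable_phaseCoeff : Summable phaseCoeff := by
  have h := (Summable.of_finite (f := fun _ : Fin 2 => (1 : ℝ))).mul_of_nonneg
    (summable_exp_neg_sqrt_sum_sq 5) (fun _ => zero_le_one) fun k => (Real.exp_pos _).le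
  exact h.congr fun k => one_mul _

section PhaseMetric

variable {q : ℝ≥0∞} [Fact (1 ≤ q)] (e : HilbertBasis (Fin 5 → ℤ) ℂ L2C5)

theorem phaseTerm_eq (U V : XPlusInf q) (ik : Fin 2 × (Fin 5 → ℤ)) :
    phaseTerm e U V ik = phaseCoeff ik * (‖fourierQ e ik.1 ik.2 U - fourierQ e ik.1 ik.2 V‖ /
      (1 + ‖fourierQ e ik.1 ik.2 U - fourierQ e ik.1 ik.2 V‖)) := rfl

theorem phaseTerm_nonneg (U V : XPlusInf q) (ik : Fin 2 × (Fin 5 → ℤ)) :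
    0 ≤ phaseTerm e U V ik := by
  unfold phaseTerm
  positivity

theorem phaseTerm_le_phaseCoeff (U V : XPlusInf q) (ik : Fin 2 × (Fin 5 → ℤ)) :
    phaseTerm e U V ik ≤ phaseCoeff ik := by
  refine mul_le_of_le_one_right (Real.exp_pos _).le ?_
  rw [div_le_one (by positivity)]
  linarith

theorem summable_phaseTerm (U V : XPlusInf q) : Summable (phaseTerm e U V) :=
  Summable.of_nonneg_of_le (phaseTerm_nonneg e U V) (phaseTerm_le_phaseCoeff e U V)
    summable_phaseCoeff

theorem phaseTerm_le_phaseDist (U V : XPlusInf q) (ik : Fin 2 × (Fin 5 → ℤ)) :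
    phaseTerm e U V ik ≤ phaseDist e U V :=
  (summable_phaseTerm e U V).le_tsum ik fun j _ => phaseTerm_nonneg e U V j

theorem phaseDist_self (U : XPlusInf q) : phaseDist e U U = 0 := by
  simp [phaseDist, phaseTerm]

theorem phaseDist_comm (U V : XPlusInf q) : phaseDist e U V = phaseDist e V U := by
  simp only [phaseDist, phaseTerm, norm_sub_rev]

theorem phaseDist_triangle (U V W : XPlusInf q) :
    phaseDist e U W ≤ phaseDist e U V + phaseDist e V W := by
  rw [phaseDist, phaseDist, phaseDist,
    ← (summable_phaseTerm e U V).tsum_add (summable_phaseTerm e V W)]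
  refine (summable_phaseTerm e U W).tsum_le_tsum (fun ik => ?_)
    ((summable_phaseTerm e U V).add (summable_phaseTerm e V W))
  rw [phaseTerm_eq, phaseTerm_eq, phaseTerm_eq, ← mul_add]
  exact mul_le_mul_of_nonneg_left (div_one_add_le_add (norm_nonneg _) (norm_nonneg _)
    (norm_nonneg _) (norm_sub_le_norm_sub_add_norm_sub _ _ _)) (phaseCoeff_pos ik).le

theorem fourierQ_zero (k : Fin 5 → ℤ) (U : XPlusInf q) : fourierQ e 0 k U = (U.weight : ℂ) :=
  if_pos rfl

theorem fourierQ_one (k : Fin 5 → ℤ) (U : XPlusInf q) :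
    fourierQ e 1 k U = (U.weight : ℂ) * fourierF e k U.toX :=
  if_neg one_ne_zero

theorem tendsto_phaseDist_iff {ι : Type*} {l : Filter ι} {u : ι → XPlusInf q} {U : XPlusInf q} :
    Tendsto (fun n => phaseDist e (u n) U) l (𝓝 0) ↔
      ∀ i k, Tendsto (fun n => fourierQ e i k (u n)) l (𝓝 (fourierQ e i k U)) := by
  have hterm : ∀ ik : Fin 2 × (Fin 5 → ℤ), Tendsto (fun n => phaseTerm e (u n) U ik) l (𝓝 0) ↔
      Tendsto (fun n => fourierQ e ik.1 ik.2 (u n)) l (𝓝 (fourierQ e ik.1 ik.2 U)) := fun ik => by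
    rw [tendsto_iff_norm_sub_tendsto_zero (f := fun n => fourierQ e ik.1 ik.2 (u n)),
      ← tendsto_div_one_add_zero_iff fun _ => norm_nonneg _]
    simpa only [phaseTerm_eq, smul_eq_mul, mul_zero] using
      tendsto_const_smul_iff₀ (a := (0 : ℝ)) (phaseCoeff_pos ik).ne'
  refine ⟨fun h i k => (hterm (i, k)).mp (squeeze_zero (fun _ => phaseTerm_nonneg e _ _ _)
    (fun _ => phaseTerm_le_phaseDist e _ _ _) h), fun h => ?_⟩
  rw [← tsum_zero (α := ℝ) (β := Fin 2 × (Fin 5 → ℤ))]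
  refine tendsto_tsum_of_dominated_convergence summable_phaseCoeff
    (fun ik => (hterm ik).mpr (h ik.1 ik.2)) (Eventually.of_forall fun n ik => ?_)
  rw [Real.norm_of_nonneg (phaseTerm_nonneg e _ _ _)]
  exact phaseTerm_le_phaseCoeff e _ _ _

theorem fourierQ_eq_of_phaseDist_eq_zero {U V : XPlusInf q} (h : phaseDist e U V = 0) (i : Fin 2)
    (k : Fin 5 → ℤ) : fourierQ e i k U = fourierQ e i k V := by
  have hlim := (tendsto_phaseDist_iff e (l := pure ()) (u := fun _ => U)).mp
    (by rw [h]; exact tendsto_const_nhds) i k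
  exact tendsto_nhds_unique tendsto_const_nhds hlim

theorem eq_of_phaseDist_eq_zero (hq : 2 ≤ q) {U V : XPlusInf q} (h : phaseDist e U V = 0) :
    U = V := by
  have hQ := fourierQ_eq_of_phaseDist_eq_zero e h
  have hweight : U.weight = V.weight := by
    simpa only [fourierQ_zero, Complex.ofReal_inj] using hQ 0 0
  refine XPlusInf.eq_of_weight_eq hweight fun hne =>
    PhaseSpace.eq_of_fourierF_eq hq e fun k => ?_
  have hQ_one := hQ 1 k
  rw [fourierQ_one, fourierQ_one, ← hweight] at hQ_one
  exact mul_left_cancel₀ (Complex.ofReal_ne_zero.mpr hne) hQ_one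

/-- `X⁺_∞` as a metric space, with the metric `d`. -/
noncomputable abbrev phaseMetric (hq : 2 ≤ q) : MetricSpace (XPlusInf q) where
  dist := phaseDist e
  dist_self := phaseDist_self e
  dist_comm := phaseDist_comm e
  dist_triangle := phaseDist_triangle e
  eq_of_dist_eq_zero := eq_of_phaseDist_eq_zero e hq

end PhaseMetric

/-! ### The topology of `X⁺_∞` -/

instance PhaseSpace.t2Space {q : ℝ≥0∞} [Fact (1 ≤ q)] : T2Space (PhaseSpace q) :=
  TopologicalSpace.t2Space_of_metrizableSpace

namespace XPlusInf

variable {q : ℝ≥0∞} [Fact (1 ≤ q)]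

/-- The map `U ↦ (G(U) U, G(U))`. Unlike the inclusion into `X`, it is continuous at `U_∞`, and it
realises `X⁺_∞` as a closed subset of `X × ℝ`. -/
noncomputable def weighted (U : XPlusInf q) : PhaseSpace q × ℝ :=
  (U.weight • U.toX, U.weight)

theorem weighted_injective : Function.Injective (weighted : XPlusInf q → PhaseSpace q × ℝ) := by
  intro U V h
  have hweight : U.weight = V.weight := congrArg Prod.snd h
  have hsmul : U.weight • U.toX = V.weight • V.toX := congrArg Prod.fst h
  rw [← hweight] at hsmul
  exact eq_of_weight_eq hweight fun hne => MulAction.injective₀ hne hsmul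

theorem ofPlus_injective : Function.Injective (ofPlus : XPlus q → XPlusInf q) :=
  fun _ _ h => Subtype.ext (congrArg toX h)

theorem ofPlus_ne_infty (U : XPlus q) : ofPlus U ≠ infty q := fun h => by
  have hU : (U : PhaseSpace q) = 0 := congrArg toX h
  exact zero_notMem_XPlus (hU ▸ U.2)

theorem range_ofPlus : Set.range (ofPlus : XPlus q → XPlusInf q) = {infty q}ᶜ := by
  ext U
  refine ⟨?_, fun hU => ?_⟩
  · rintro ⟨V, rfl⟩
    exact ofPlus_ne_infty V
  · have hmem : U.toX ∈ XPlus q := not_imp_comm.mp eq_infty_of_notMem hU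
    exact ⟨⟨U.toX, hmem⟩, rfl⟩

section Metric

variable [MetricSpace (XPlusInf q)] {e : HilbertBasis (Fin 5 → ℤ) ℂ L2C5}
  (hd : ∀ U V : XPlusInf q, dist U V = phaseDist e U V)
include hd

section Limits

variable {ι : Type*} {l : Filter ι} {u : ι → XPlusInf q} {U : XPlusInf q}

theorem tendsto_iff_fourierQ : Tendsto u l (𝓝 U) ↔
    ∀ i k, Tendsto (fun n => fourierQ e i k (u n)) l (𝓝 (fourierQ e i k U)) := by
  rw [← tendsto_phaseDist_iff, tendsto_iff_dist_tendsto_zero]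
  simp only [hd]

theorem tendsto_weight (h : Tendsto u l (𝓝 U)) :
    Tendsto (fun i => (u i).weight) l (𝓝 U.weight) := by
  have hQ := (tendsto_iff_fourierQ hd).mp h 0 0
  simp only [fourierQ_zero] at hQ
  exact_mod_cast (Complex.continuous_re.tendsto _).comp hQ

theorem tendsto_infty_iff_weight (hq : 2 ≤ q) :
    Tendsto u l (𝓝 (infty q)) ↔ Tendsto (fun i => (u i).weight) l (𝓝 0) := by
  refine ⟨fun h => weight_infty (q := q) ▸ tendsto_weight hd h, fun h => ?_⟩
  refine (tendsto_iff_fourierQ hd).mpr fun i k => ?_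
  fin_cases i
  · simp only [Fin.zero_eta, fourierQ_zero, weight_infty]
    exact (Complex.continuous_ofReal.tendsto 0).comp h
  · simp only [Fin.mk_one, fourierQ_one, weight_infty, Complex.ofReal_zero, zero_mul]
    have hbound := (tendsto_weight_smul_zero h).norm.const_mul ‖PhaseSpace.toL2C5 (q := q) hq‖
    rw [norm_zero, mul_zero] at hbound
    refine squeeze_zero_norm (fun n => ?_) hbound
    rw [norm_mul, norm_smul, Complex.norm_real, mul_left_comm]
    gcongr
    exact PhaseSpace.norm_fourierF_le hq e k _

theorem tendsto_infty_iff (hq : 2 ≤ q) : Tendsto u l (𝓝 (infty q)) ↔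
    ∀ M : ℝ, 0 < M → ∀ᶠ i in l, u i = infty q ∨ M < (u i).toX.size :=
  (tendsto_infty_iff_weight hd hq).trans tendsto_weight_zero_iff

theorem tendsto_ofPlus_infty_iff (hq : 2 ≤ q) {v : ι → XPlus q} :
    Tendsto (fun i => ofPlus (v i)) l (𝓝 (infty q)) ↔
      Tendsto (fun i => (v i : PhaseSpace q).size) l atTop := by
  simp only [tendsto_infty_iff hd hq, ofPlus_ne_infty, false_or]
  exact ⟨fun h => tendsto_atTop.mpr fun M => (h (max M 1) (by positivity)).mono fun i hi =>
    (le_max_left _ _).trans hi.le, fun h M _ => h.eventually_gt_atTop M⟩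

theorem tendsto_fourierF (hU : U.toX ∈ XPlus q) (h : Tendsto u l (𝓝 U)) (k : Fin 5 → ℤ) :
    Tendsto (fun i => fourierF e k (u i).toX) l (𝓝 (fourierF e k U.toX)) := by
  have hquot : ∀ V : XPlusInf q, V.toX ∈ XPlus q →
      fourierQ e 1 k V / fourierQ e 0 k V = fourierF e k V.toX := fun V hV => by
    rw [fourierQ_one, fourierQ_zero, mul_div_cancel_left₀ _
      (Complex.ofReal_ne_zero.mpr (weight_pos_of_mem hV).ne')]
  have hne : fourierQ e 0 k U ≠ 0 := by
    rw [fourierQ_zero]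
    exact Complex.ofReal_ne_zero.mpr (weight_pos_of_mem hU).ne'
  have hQ := (tendsto_iff_fourierQ hd).mp h
  rw [← hquot U hU]
  refine ((hQ 1 k).div (hQ 0 k) hne).congr' ?_
  filter_upwards [eventually_mem_XPlus (weight_pos_of_mem hU) (tendsto_weight hd h)]
    with i hi using hquot _ hi

theorem tendsto_of_tendsto_toX (hq3 : 3 < q) (hq_top : q ≠ ⊤) (hU : U.toX ∈ XPlus q)
    (hu : ∀ᶠ i in l, (u i).toX ∈ XPlus q) (h : Tendsto (fun i => (u i).toX) l (𝓝 U.toX)) :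
    Tendsto u l (𝓝 U) := by
  have hweight := (Complex.continuous_ofReal.tendsto _).comp
    (tendsto_weight_of_tendsto_toX hq3 hq_top hU hu h)
  refine (tendsto_iff_fourierQ hd).mpr fun i k => ?_
  fin_cases i
  · simp only [Fin.zero_eta, fourierQ_zero]
    exact hweight
  · simp only [Fin.mk_one, fourierQ_one]
    exact hweight.mul
      (((PhaseSpace.continuous_fourierF (two_le_of_three_lt hq3) e k).tendsto _).comp h)

theorem tendsto_iff_of_mem (hq3 : 3 < q) (hq_top : q ≠ ⊤) (hU : U.toX ∈ XPlus q) :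
    Tendsto u l (𝓝 U) ↔ (∀ᶠ i in l, (u i).toX ∈ XPlus q) ∧
      Tendsto (fun i => (u i).toX) l (𝓝 U.toX) := by
  refine ⟨fun h => ?_, fun ⟨hu, h⟩ => tendsto_of_tendsto_toX hd hq3 hq_top hU hu h⟩
  have hpos := weight_pos_of_mem hU
  have hweight := tendsto_weight hd h
  have hu := eventually_mem_XPlus hpos hweight
  have hsize := tendsto_size_of_tendsto_weight hpos hweight
  rw [← size_eq_of_mem hU] at hsize
  exact ⟨hu, PhaseSpace.tendsto_of_tendsto_size (two_le_of_three_lt hq3) hq_top e hu hsize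
    (tendsto_fourierF hd hU h)⟩

end Limits

section ClosedEmbedding

theorem continuous_weighted (hq3 : 3 < q) (hq_top : q ≠ ⊤) :
    Continuous (weighted : XPlusInf q → PhaseSpace q × ℝ) := by
  refine continuous_iff_continuousAt.mpr fun U => ?_
  have hweight := tendsto_weight hd (tendsto_id (x := 𝓝 U))
  refine Tendsto.prodMk_nhds ?_ hweight
  by_cases hU : U.toX ∈ XPlus q
  · exact hweight.smul ((tendsto_iff_of_mem hd hq3 hq_top hU).mp tendsto_id).2
  · rw [weight_of_notMem hU] at hweight ⊢
    rw [zero_smul]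
    exact tendsto_weight_smul_zero hweight

variable {u : ℕ → XPlusInf q} {X : PhaseSpace q} {g : ℝ}

theorem exists_tendsto_of_tendsto_weight_pos (hq3 : 3 < q) (hq_top : q ≠ ⊤) (hg : 0 < g)
    (hweight : Tendsto (fun n => (u n).weight) atTop (𝓝 g))
    (hsmul : Tendsto (fun n => (u n).weight • (u n).toX) atTop (𝓝 X)) :
    ∃ U : XPlusInf q, Tendsto u atTop (𝓝 U) := by
  have hu := eventually_mem_XPlus hg hweight
  have hsize := tendsto_size_of_tendsto_weight hg hweight
  have htoX : Tendsto (fun n => (u n).toX) atTop (𝓝 (g⁻¹ • X)) := by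
    refine ((hweight.inv₀ hg.ne').smul hsmul).congr' ?_
    filter_upwards [hu] with n hn using inv_smul_smul₀ (weight_pos_of_mem hn).ne' _
  have hmem : g⁻¹ • X ∈ XPlus q := PhaseSpace.mem_XPlus_of_tendsto hq3 hq_top
    (hu.and ((hsize.eventually (gt_mem_nhds (lt_add_one _))).mono fun _ => le_of_lt)) htoX
  exact ⟨ofPlus ⟨_, hmem⟩, tendsto_of_tendsto_toX hd hq3 hq_top hmem hu htoX⟩

theorem exists_tendsto_of_tendsto_weighted (hq3 : 3 < q) (hq_top : q ≠ ⊤)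
    (h : Tendsto (fun n => (u n).weighted) atTop (𝓝 (X, g))) :
    ∃ U : XPlusInf q, Tendsto u atTop (𝓝 U) := by
  obtain ⟨hsmul, hweight⟩ := (Prod.tendsto_iff _ _).mp h
  rcases (ge_of_tendsto' hweight fun n => weight_nonneg _).eq_or_lt with rfl | hg
  · exact ⟨infty q, (tendsto_infty_iff_weight hd (two_le_of_three_lt hq3)).mpr hweight⟩
  · exact exists_tendsto_of_tendsto_weight_pos hd hq3 hq_top hg hweight hsmul

theorem isClosedEmbedding_weighted (hq3 : 3 < q) (hq_top : q ≠ ⊤) :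
    IsClosedEmbedding (weighted : XPlusInf q → PhaseSpace q × ℝ) := by
  have hcont := continuous_weighted hd hq3 hq_top
  refine .of_continuous_injective_isClosedMap hcont weighted_injective
    fun s hs => IsSeqClosed.isClosed fun v y hv hy => ?_
  choose u hus huv using hv
  obtain rfl : (fun n => weighted (u n)) = v := funext huv
  obtain ⟨U, hU⟩ := exists_tendsto_of_tendsto_weighted hd hq3 hq_top hy
  exact ⟨U, hs.isSeqClosed hus hU, tendsto_nhds_unique ((hcont.tendsto U).comp hU) hy⟩

theorem polishSpace (hq3 : 3 < q) (hq_top : q ≠ ⊤) : PolishSpace (XPlusInf q) := by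
  have : SecondCountableTopology (Sobolev 1 q ℝ) := Sobolev.secondCountableTopology hq_top
  have : SecondCountableTopology (Sobolev 2 2 ℝ) := Sobolev.secondCountableTopology (by simp)
  have : SecondCountableTopology (Sobolev 2 2 (EuclideanSpace ℝ (Fin 3))) :=
    Sobolev.secondCountableTopology (by simp)
  exact (isClosedEmbedding_weighted hd hq3 hq_top).polishSpace

end ClosedEmbedding

section BoundedContinuous

theorem tendsto_ofPlus_iff (hq3 : 3 < q) (hq_top : q ≠ ⊤) {ι : Type*} {l : Filter ι}
    {v : ι → XPlus q} {V : XPlus q} :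
    Tendsto (fun i => ofPlus (v i)) l (𝓝 (ofPlus V)) ↔ Tendsto v l (𝓝 V) := by
  rw [tendsto_subtype_rng]
  exact (tendsto_iff_of_mem hd hq3 hq_top (U := ofPlus V) V.2).trans
    (and_iff_right (Eventually.of_forall fun i => (v i).2))

theorem isOpenEmbedding_ofPlus (hq3 : 3 < q) (hq_top : q ≠ ⊤) :
    IsOpenEmbedding (ofPlus : XPlus q → XPlusInf q) := by
  refine ⟨⟨isInducing_iff_nhds.mpr fun U => le_antisymm ?_ ?_, ofPlus_injective⟩, ?_⟩
  · exact tendsto_iff_comap.mp ((tendsto_ofPlus_iff hd hq3 hq_top).mpr tendsto_id)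
  · exact (tendsto_ofPlus_iff hd hq3 hq_top (v := id)).mp tendsto_comap
  · rw [range_ofPlus]
    exact isOpen_compl_singleton

theorem comap_ofPlus_nhds_infty (hq : 2 ≤ q) :
    comap (ofPlus : XPlus q → XPlusInf q) (𝓝 (infty q)) =
      comap (fun U : XPlus q => (U : PhaseSpace q).size) atTop :=
  le_antisymm (tendsto_iff_comap.mp ((tendsto_ofPlus_infty_iff hd hq).mp tendsto_comap))
    (tendsto_iff_comap.mp ((tendsto_ofPlus_infty_iff hd hq).mpr tendsto_comap))

theorem continuousAt_infty_iff (hq : 2 ≤ q) {Y : Type*} [TopologicalSpace Y] {F : XPlusInf q → Y} :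
    ContinuousAt F (infty q) ↔ Tendsto (fun U : XPlus q => F (ofPlus U))
      (comap (fun U : XPlus q => (U : PhaseSpace q).size) atTop) (𝓝 (F (infty q))) := by
  rw [continuousAt_iff_punctured_nhds, nhdsWithin, ← range_ofPlus, ← map_comap, tendsto_map'_iff,
    comap_ofPlus_nhds_infty hd hq]
  rfl

theorem continuous_iff (hq3 : 3 < q) (hq_top : q ≠ ⊤) {Y : Type*} [TopologicalSpace Y]
    {F : XPlusInf q → Y} :
    Continuous F ↔ Continuous (fun U : XPlus q => F (ofPlus U)) ∧
      Tendsto (fun U : XPlus q => F (ofPlus U))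
        (comap (fun U : XPlus q => (U : PhaseSpace q).size) atTop) (𝓝 (F (infty q))) := by
  have hopen := isOpenEmbedding_ofPlus hd hq3 hq_top
  rw [← continuousAt_infty_iff hd (two_le_of_three_lt hq3)]
  refine ⟨fun hF => ⟨hF.comp hopen.continuous, hF.continuousAt⟩, fun ⟨hF, hinfty⟩ =>
    continuous_iff_continuousAt.mpr fun U => ?_⟩
  rcases eq_or_ne U (infty q) with rfl | hU
  · exact hinfty
  · obtain ⟨V, rfl⟩ : U ∈ Set.range ofPlus := range_ofPlus.ge hU
    exact hopen.continuousAt_iff.mp hF.continuousAt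

end BoundedContinuous

end Metric

theorem exists_forall_abs_le_iff {F : XPlusInf q → ℝ} :
    (∃ C : ℝ, ∀ U, |F U| ≤ C) ↔ ∃ C : ℝ, ∀ U : XPlus q, |F (ofPlus U)| ≤ C := by
  refine ⟨fun ⟨C, hC⟩ => ⟨C, fun U => hC _⟩, fun ⟨C, hC⟩ => ⟨max C |F (infty q)|, fun U => ?_⟩⟩
  by_cases hU : U.toX ∈ XPlus q
  · exact (hC ⟨U.toX, hU⟩).trans (le_max_left _ _)
  · rw [eq_infty_of_notMem hU]
    exact le_max_right _ _

theorem classC_eq [MetricSpace (XPlusInf q)] {e : HilbertBasis (Fin 5 → ℤ) ℂ L2C5}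
    (hd : ∀ U V : XPlusInf q, dist U V = phaseDist e U V) (hq3 : 3 < q) (hq_top : q ≠ ⊤) :
    classC q = {F : XPlusInf q → ℝ | Continuous F ∧ ∃ C : ℝ, ∀ U, |F U| ≤ C} := by
  ext F
  rw [Set.mem_ofPred_eq, continuous_iff hd hq3 hq_top, exists_forall_abs_le_iff, and_right_comm,
    and_assoc]
  rfl

end XPlusInf

theorem mainTheorem3_general (q : ℝ≥0∞) [Fact (1 ≤ q)] (hq3 : 3 < q) (hq_top : q ≠ ⊤)
    (e : HilbertBasis (Fin 5 → ℤ) ℂ L2C5) :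
    (∀ U V : XPlusInf q, Summable (phaseTerm e U V)) ∧
    ∃ m : MetricSpace (XPlusInf q),
      (∀ U V : XPlusInf q, dist U V = phaseDist e U V) ∧
      PolishSpace (XPlusInf q) ∧
      (∀ (u : ℕ → XPlusInf q) (U : XPlusInf q), U.toX ∈ XPlus q →
        (Tendsto u atTop (𝓝 U) ↔
          (∀ᶠ n in atTop, (u n).toX ∈ XPlus q) ∧
            Tendsto (fun n => (u n).toX) atTop (𝓝 U.toX))) ∧
      (∀ u : ℕ → XPlusInf q,
        (Tendsto u atTop (𝓝 (XPlusInf.infty q)) ↔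
          ∀ M : ℝ, 0 < M → ∃ N : ℕ, ∀ n ≥ N,
            u n = XPlusInf.infty q ∨ M < (u n).toX.size)) ∧
      XPlusInf.classC q =
        {F : XPlusInf q → ℝ | Continuous F ∧ ∃ C : ℝ, ∀ U, |F U| ≤ C} := by
  have hq2 := two_le_of_three_lt hq3
  refine ⟨summable_phaseTerm e, phaseMetric e hq2, ?_⟩
  let _ := phaseMetric e hq2
  have hd : ∀ U V : XPlusInf q, dist U V = phaseDist e U V := fun _ _ => rfl
  refine ⟨hd, XPlusInf.polishSpace hd hq3 hq_top,
    fun u U => XPlusInf.tendsto_iff_of_mem hd hq3 hq_top, fun u => ?_,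
    XPlusInf.classC_eq hd hq3 hq_top⟩
  simpa only [eventually_atTop] using XPlusInf.tendsto_infty_iff hd hq2 (u := u) (l := atTop)

theorem mainTheorem3 (q : ℝ≥0∞) [Fact (1 ≤ q)] (hq3 : 3 < q) (hq6 : q ≤ 6)
    (e : HilbertBasis (Fin 5 → ℤ) ℂ L2C5)
    (he : ∀ k, IsTrigPoly (e k : T3 → EuclideanSpace ℂ (Fin 5))) :
    (∀ U V : XPlusInf q, Summable (phaseTerm e U V)) ∧
    ∃ m : MetricSpace (XPlusInf q),
      (∀ U V : XPlusInf q, dist U V = phaseDist e U V) ∧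
      PolishSpace (XPlusInf q) ∧
      (∀ (u : ℕ → XPlusInf q) (U : XPlusInf q), U.toX ∈ XPlus q →
        (Tendsto u atTop (𝓝 U) ↔
          (∀ᶠ n in atTop, (u n).toX ∈ XPlus q) ∧
            Tendsto (fun n => (u n).toX) atTop (𝓝 U.toX))) ∧
      (∀ u : ℕ → XPlusInf q,
        (Tendsto u atTop (𝓝 (XPlusInf.infty q)) ↔
          ∀ M : ℝ, 0 < M → ∃ N : ℕ, ∀ n ≥ N,
            u n = XPlusInf.infty q ∨ M < (u n).toX.size)) ∧
      XPlusInf.classC q =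
        {F : XPlusInf q → ℝ | Continuous F ∧ ∃ C : ℝ, ∀ U, |F U| ≤ C} :=
  mainTheorem3_general q hq3 (hq6.trans_lt (by simp)).ne e
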